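/- **Definitions.** A *hypergraph grammar* consists of a finite set of non-terminal symbols with arities, finite sets of arc labels (terminals of arity two) and of colours (terminals of arity one), a start symbol $Z$ of arity $0$, and exactly one rule $(H_A,\iota_A)$ for each non-terminal $A$. Here $H_A$ is a finite set of hyperarcs of positive arity labelled by these symbols (a non-terminal hyperarc having pairwise distinct vertices), and $\iota_A$ is an injection from the positions of $A$ to the vertices of $H_A$. A complete parallel rewriting step replaces simultaneously each non-terminal hyperarc $A v_1\cdots v_p$ by a copy of $H_A$ in which $\iota_A(i)$ is identified with $v_i$ and all other vertices are new. The generated graph is the union of the arcs and colours of the hypergraphs $H_0=Z, H_1, H_2,\dots$ obtained by iterating such steps; it is unique up to isomorphism. A *probabilistic hypergraph grammar* $\mathcal P$ is a hypergraph grammar with a map $\mu$ from arc labels to $\mathbb Q\cap[0,1]$ such that each vertex of the generated graph has finitely many outgoing arcs and the sum of their $\mu$-values is $1$. It induces a Markov chain $\mathcal M_{\mathcal P}$ on the vertices of the generated graph: the probability of moving from $s$ to $t$ is the sum of the $\mu$-values of the arcs from $s$ to $t$. PCTL formulae are given by $$\varphi ::= \mathtt{tt}\mid a\mid \neg\varphi\mid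 \varphi\wedge\varphi\mid \mathsf X^{\sim\rho}\varphi\mid \varphi\,\mathsf U^{\sim\rho}\varphi,\qquad {\sim}\in\{\le,<,>,\ge\},\ \rho\in\mathbb Q\cap[0,1],$$ where the atoms $a$ are the colours of $\mathcal P$. A vertex satisfies $a$ if it has the colour $a$; it satisfies $\mathsf X^{\sim\rho}\varphi$ (respectively $\varphi\,\mathsf U^{\sim\rho}\psi$) if the probability $p$ of the set of infinite paths of $\mathcal M_{\mathcal P}$ from it whose second state satisfies $\varphi$ (respectively which reach a state that satisfies $\psi$ after visiting only states that satisfy $\varphi$) has $p\sim\rho$. The other cases are as usual. **Theorem.** The exact quantitative PCTL model-checking problem for probabilistic hypergraph grammars is undecidable: there is no algorithm which, given a probabilistic hypergraph grammar $\mathcal P$ and a PCTL formula $\varphi$, decides whether $\varphi$ is valid on $\mathcal M_{\mathcal P}$. This holds for each of the following three meanings of "valid on $\mathcal M_{\mathcal P}$": 1. every vertex of $\mathcal M_{\mathcal P}$ satisfies $\varphi$; 2. some vertex of $\mathcal M_{\mathcal P}$ satisfies $\varphi$; 3. a given initial vertex $v_0$ satisfies $\varphi$, where $v_0$ is a vertex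 of $H_Z$ (part of the input) whose image is a vertex of the generated graph. -/

import Mathlib

open MeasureTheory ProbabilityTheory
open scoped ENNReal

namespace ProbHypergraph

/-! ## Hypergraphs -/

/-- Hyperarcs over the vertex set `V`: a non-terminal symbol applied to a tuple of vertices, an arc
(a terminal of arity two with a source and a target), or a colour (a terminal of arity one). -/
inductive Hyperarc (N L C V : Type) : Type
  | nonterm (A : N) (w : List V)
  | arc (a : L) (s t : V)
  | colour (c : C) (v : V)

namespace Hyperarc

variable {N L C V W : Type}

/-- The vertices that occur in a hyperarc. -/
def verts : Hyperarc N L C V → List V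
  | nonterm _ w => w
  | arc _ s t => [s, t]
  | colour _ v => [v]

/-- Renaming of the vertices of a hyperarc. -/
def map (h : V → W) : Hyperarc N L C V → Hyperarc N L C W
  | nonterm A w => nonterm A (w.map h)
  | arc a s t => arc a (h s) (h t)
  | colour c v => colour c (h v)

/-- Terminal hyperarcs are the arcs and the colours. -/
def IsTerminal : Hyperarc N L C V → Prop
  | nonterm _ _ => False
  | arc _ _ _ => True
  | colour _ _ => True

end Hyperarc

/-- The vertex set of a hypergraph: the vertices that occur in some hyperarc. -/
def vertexSet {N L C V : Type} (M : Set (Hyperarc N L C V)) : Set V :=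
  {v | ∃ e ∈ M, v ∈ e.verts}

/-- The set `[M]` of the terminal arcs and colours of a hypergraph. -/
def terminalPart {N L C V : Type} (M : Set (Hyperarc N L C V)) : Set (Hyperarc N L C V) :=
  {e ∈ M | e.IsTerminal}

/-! ## Hypergraph grammars -/

/-- Hypergraph grammars. The non-terminals, the arc labels and the colours are the elements of three
finite alphabets. Each non-terminal `A` has exactly one rule: the finite hypergraph `rhs A` (listed
by its hyperarcs, vertices being named by natural numbers), and the repetition-free list `inputs A`
of its input vertices, one for each position of a hyperarc labelled `A`. -/
structure HRGrammar where
  numNonterm : ℕ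
  numLabels : ℕ
  numColours : ℕ
  /-- the arity of a non-terminal -/
  rank : Fin numNonterm → ℕ
  /-- the start symbol, of arity zero -/
  start : Fin numNonterm
  rank_start : rank start = 0
  rhs : Fin numNonterm → List (Hyperarc (Fin numNonterm) (Fin numLabels) (Fin numColours) ℕ)
  inputs : Fin numNonterm → List ℕ
  length_inputs : ∀ A, (inputs A).length = rank A
  nodup_inputs : ∀ A, (inputs A).Nodup
  inputs_mem : ∀ A, ∀ x ∈ inputs A, x ∈ vertexSet {e | e ∈ rhs A}
  /-- Hyperarcs have the right number of vertices, which is positive, and a non-terminal hyperarc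
  has pairwise distinct vertices: otherwise no injective map could rewrite it. -/
  rhs_wf : ∀ A B w, Hyperarc.nonterm B w ∈ rhs A → w.length = rank B ∧ w ≠ [] ∧ w.Nodup

namespace HRGrammar

variable (G : HRGrammar)

/-- Hypergraphs labelled by the symbols of the grammar, with natural numbers as vertices. -/
abbrev Hypergraph : Type :=
  Set (Hyperarc (Fin G.numNonterm) (Fin G.numLabels) (Fin G.numColours) ℕ)

/-- The hypergraph on the right-hand side of the rule of `A`. -/
def ruleGraph (A : Fin G.numNonterm) : G.Hypergraph := {e | e ∈ G.rhs A}

/-- The vertices of a right-hand side that are not inputs. -/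
def newVertices (A : Fin G.numNonterm) : Set ℕ :=
  {x | x ∈ vertexSet (G.ruleGraph A) ∧ x ∉ G.inputs A}

/-- `M'` is obtained from `M` by one complete parallel rewriting step: every non-terminal hyperarc
`A w` of `M` is replaced by the image of the right-hand side of `A` under the map `h A w`, which
is injective, maps the inputs to `w`, and maps the other vertices to vertices outside `M`; distinct
hyperarcs create distinct vertices. -/
structure Rewrites (M M' : G.Hypergraph) (h : Fin G.numNonterm → List ℕ → ℕ → ℕ) : Prop where
  map_inputs : ∀ A w, Hyperarc.nonterm A w ∈ M → (G.inputs A).map (h A w) = w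
  injOn : ∀ A w, Hyperarc.nonterm A w ∈ M → Set.InjOn (h A w) (vertexSet (G.ruleGraph A))
  fresh : ∀ A w, Hyperarc.nonterm A w ∈ M → ∀ x ∈ G.newVertices A, h A w x ∉ vertexSet M
  disjoint : ∀ A w, Hyperarc.nonterm A w ∈ M → ∀ B u, Hyperarc.nonterm B u ∈ M →
    (A, w) ≠ (B, u) → ∀ x ∈ G.newVertices A, ∀ y ∈ G.newVertices B, h A w x ≠ h B u y
  result : M' = terminalPart M ∪
    {e | ∃ A w, Hyperarc.nonterm A w ∈ M ∧ ∃ r ∈ G.ruleGraph A, e = r.map (h A w)}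

/-- The hypergraph that consists of the start symbol alone. -/
def startGraph : G.Hypergraph := {Hyperarc.nonterm G.start []}

/-- An infinite sequence of complete parallel rewriting steps from the start symbol. -/
structure Derivation where
  H : ℕ → G.Hypergraph
  h : ℕ → Fin G.numNonterm → List ℕ → ℕ → ℕ
  H_zero : H 0 = G.startGraph
  step : ∀ n, G.Rewrites (H n) (H (n + 1)) (h n)

/-- The graph generated by a derivation: all the terminal arcs and colours that it produces. -/
def Derivation.graph {G : HRGrammar} (D : G.Derivation) : G.Hypergraph :=
  ⋃ n, terminalPart (D.H n)

/-- The vertex of the generated graph that comes from the vertex `x` of the right-hand side of the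
start symbol. -/
def Derivation.rootImage {G : HRGrammar} (D : G.Derivation) (x : ℕ) : ℕ :=
  D.h 0 G.start [] x

/-! Every grammar has a derivation. -/

/-- An auxiliary invariant of derivations. -/
def Good (M : G.Hypergraph) : Prop :=
  (vertexSet M).Finite ∧ ({p : Fin G.numNonterm × List ℕ | Hyperarc.nonterm p.1 p.2 ∈ M}).Finite ∧
    ∀ A w, Hyperarc.nonterm A w ∈ M → w.length = G.rank A ∧ w.Nodup

theorem vertexSet_ruleGraph_finite (A : Fin G.numNonterm) :
    (vertexSet (G.ruleGraph A)).Finite := by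
  have : vertexSet (G.ruleGraph A) = {v | v ∈ (G.rhs A).flatMap Hyperarc.verts} := by
    ext v
    simp [vertexSet, ruleGraph]
  rw [this]
  exact List.finite_toSet _

theorem mem_verts_map {N L C V W : Type} (h : V → W) (e : Hyperarc N L C V) :
    (e.map h).verts = e.verts.map h := by
  cases e <;> simp [Hyperarc.map, Hyperarc.verts]

theorem exists_rewrites (M : G.Hypergraph) (hM : G.Good M) :
    ∃ h M', G.Rewrites M M' h ∧ G.Good M' := by
  classical
  obtain ⟨hfin, hnt, hwf⟩ := hM
  obtain ⟨b, hb⟩ := hfin.bddAbove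
  let h : Fin G.numNonterm → List ℕ → ℕ → ℕ := fun A w x =>
    if x ∈ G.inputs A then w.getD ((G.inputs A).idxOf x) 0
    else b + 1 + Encodable.encode ((A, w), x)
  have hnew : ∀ A w x, x ∉ G.inputs A → h A w x = b + 1 + Encodable.encode ((A, w), x) := by
    intro A w x hx
    simp [h, hx]
  have hget : ∀ A w, Hyperarc.nonterm A w ∈ M → ∀ x (hx : x ∈ G.inputs A),
      ∃ hl : (G.inputs A).idxOf x < w.length, h A w x = w[(G.inputs A).idxOf x] := by
    intro A w hAw x hx
    have hl : (G.inputs A).idxOf x < w.length := by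
      rw [(hwf A w hAw).1, ← G.length_inputs A]
      exact List.idxOf_lt_length_iff.2 hx
    refine ⟨hl, ?_⟩
    simp [h, hx, hl]
  have hle : ∀ A w, Hyperarc.nonterm A w ∈ M → ∀ x ∈ G.inputs A, h A w x ≤ b := by
    intro A w hAw x hx
    obtain ⟨hl, e⟩ := hget A w hAw x hx
    rw [e]
    exact hb ⟨_, hAw, List.getElem_mem hl⟩
  have hinj : ∀ A w, Hyperarc.nonterm A w ∈ M → Function.Injective (h A w) := by
    intro A w hAw x y hxy
    by_cases hx : x ∈ G.inputs A <;> by_cases hy : y ∈ G.inputs A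
    · obtain ⟨hlx, ex⟩ := hget A w hAw x hx
      obtain ⟨hly, ey⟩ := hget A w hAw y hy
      rw [ex, ey] at hxy
      have := (List.Nodup.getElem_inj_iff (hwf A w hAw).2).1 hxy
      exact (List.idxOf_inj hx).1 this
    · have h1 := hle A w hAw x hx
      rw [hxy, hnew A w y hy] at h1
      omega
    · have h1 := hle A w hAw y hy
      rw [← hxy, hnew A w x hx] at h1
      omega
    · rw [hnew A w x hx, hnew A w y hy] at hxy
      have := Encodable.encode_injective (Nat.add_left_cancel hxy)
      exact (Prod.mk.inj this).2
  refine ⟨h, _, ⟨?_, ?_, ?_, ?_, rfl⟩, ?_, ?_, ?_⟩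
  · intro A w hAw
    apply List.ext_getElem
    · rw [List.length_map, G.length_inputs, (hwf A w hAw).1]
    · intro i h1 h2
      rw [List.getElem_map]
      obtain ⟨hl, e⟩ := hget A w hAw _ (List.getElem_mem (by simpa using h1))
      rw [e]
      congr 1
      exact List.Nodup.idxOf_getElem (G.nodup_inputs A) i (by simpa using h1)
  · intro A w hAw
    exact (hinj A w hAw).injOn
  · intro A w _ x hx hmem
    have := hb hmem
    rw [hnew A w x hx.2] at this
    omega
  · intro A w _ B u _ hne x hx y hy hxy
    rw [hnew A w x hx.2, hnew B u y hy.2] at hxy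
    have := Encodable.encode_injective (Nat.add_left_cancel hxy)
    exact hne (Prod.mk.inj this).1
  · have hU : (⋃ p ∈ {p : Fin G.numNonterm × List ℕ | Hyperarc.nonterm p.1 p.2 ∈ M},
        h p.1 p.2 '' vertexSet (G.ruleGraph p.1)).Finite :=
      hnt.biUnion fun p _ => (G.vertexSet_ruleGraph_finite p.1).image _
    refine (hfin.union hU).subset ?_
    rintro v ⟨e, he | ⟨A, w, hAw, r, hr, rfl⟩, hv⟩
    · exact Or.inl ⟨e, he.1, hv⟩
    · rw [mem_verts_map, List.mem_map] at hv
      obtain ⟨x, hx, rfl⟩ := hv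
      right
      simp only [Set.mem_iUnion]
      exact ⟨(A, w), hAw, x, ⟨r, hr, hx⟩, rfl⟩
  · let f : (Fin G.numNonterm × List ℕ) →
        Hyperarc (Fin G.numNonterm) (Fin G.numLabels) (Fin G.numColours) ℕ → Fin G.numNonterm × List ℕ :=
      fun p e => match e.map (h p.1 p.2) with
        | .nonterm B u => (B, u)
        | .arc _ _ _ => p
        | .colour _ _ => p
    have hU : (⋃ p ∈ {p : Fin G.numNonterm × List ℕ | Hyperarc.nonterm p.1 p.2 ∈ M},
        f p '' {e | e ∈ G.rhs p.1}).Finite :=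
      hnt.biUnion fun p _ => (List.finite_toSet _).image _
    refine hU.subset ?_
    rintro ⟨B, u⟩ (he | ⟨A, w, hAw, r, hr, he⟩)
    · exact he.2.elim
    · simp only [Set.mem_iUnion]
      refine ⟨(A, w), hAw, r, hr, ?_⟩
      simp only at he
      simp [f, ← he]
  · rintro B u (he | ⟨A, w, hAw, r, hr, he⟩)
    · exact he.2.elim
    · cases r with
      | arc a s t => simp [Hyperarc.map] at he
      | colour c v => simp [Hyperarc.map] at he
      | nonterm B' u' =>
        simp only [Hyperarc.map, Hyperarc.nonterm.injEq] at he
        obtain ⟨rfl, rfl⟩ := he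
        have := G.rhs_wf A B u' hr
        exact ⟨by rw [List.length_map]; exact this.1, this.2.2.map (hinj A w hAw)⟩

theorem nonempty_derivation : Nonempty G.Derivation := by
  have h0 : G.Good G.startGraph := by
    refine ⟨?_, ?_, ?_⟩
    · have : vertexSet G.startGraph = ∅ := by
        ext v
        simp [vertexSet, startGraph, Hyperarc.verts]
      rw [this]
      exact Set.finite_empty
    · refine (Set.finite_singleton (G.start, ([] : List ℕ))).subset ?_
      rintro ⟨A, w⟩ he
      simpa [startGraph] using he
    · intro A w he
      simp only [startGraph, Set.mem_singleton_iff, Hyperarc.nonterm.injEq] at he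
      obtain ⟨rfl, rfl⟩ := he
      simp [G.rank_start]
  choose h M' hR hG using G.exists_rewrites
  let S : ℕ → {M : G.Hypergraph // G.Good M} := fun n =>
    Nat.rec ⟨G.startGraph, h0⟩ (fun _ M => ⟨M' M.1 M.2, hG M.1 M.2⟩) n
  exact ⟨⟨fun n => (S n).1, fun n => h (S n).1 (S n).2, rfl, fun n => hR (S n).1 (S n).2⟩⟩

/-- A chosen derivation. The generated graph does not depend on it, up to isomorphism. -/
noncomputable def derivation : G.Derivation := Classical.choice G.nonempty_derivation

/-- The graph `R^ω` generated by the grammar. -/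
noncomputable def graph : G.Hypergraph := G.derivation.graph

end HRGrammar

/-! ## Markov chains and PCTL -/

/-- Labelled Markov chains: `step s t` is the probability to move from `s` to `t`, and `label s` is
the set of the atomic propositions that hold in `s`. -/
structure LabelledMarkovChain (S AP : Type) where
  step : S → PMF S
  label : S → Set AP

namespace LabelledMarkovChain

variable {S AP : Type} [MeasurableSpace S] [DiscreteMeasurableSpace S] [Countable S]

/-- The one-step transition kernel. -/
noncomputable def kernel (M : LabelledMarkovChain S AP) : Kernel S S :=
  Kernel.ofFunOfCountable fun s => (M.step s).toMeasure

instance (M : LabelledMarkovChain S AP) : IsMarkovKernel M.kernel :=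
  ⟨fun s => by change IsProbabilityMeasure (M.step s).toMeasure; infer_instance⟩

/-- The law of the infinite paths of the chain that start in `s`. -/
noncomputable def pathMeasure (M : LabelledMarkovChain S AP) (s : S) : Measure (ℕ → S) :=
  Kernel.traj (X := fun _ => S)
    (fun n => M.kernel.comap (fun x : (i : Finset.Iic n) → S => x ⟨n, Finset.mem_Iic.2 le_rfl⟩)
      (measurable_pi_apply _))
    0 (fun _ => s)

end LabelledMarkovChain

/-- Rational numbers in the unit interval. -/
abbrev RatProb : Type := Set.Icc (0 : ℚ) 1

/-- The comparison symbols of PCTL. -/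
inductive Comparison
  | le
  | lt
  | gt
  | ge

/-- The comparison of a real number with a threshold. -/
def Comparison.holds : Comparison → ℝ → ℝ → Prop
  | le, x, r => x ≤ r
  | lt, x, r => x < r
  | gt, x, r => x > r
  | ge, x, r => x ≥ r

/-- PCTL formulae over the atomic propositions `AP`, with rational thresholds. -/
inductive PCTL (AP : Type) : Type
  | tt
  | atom (a : AP)
  | neg (φ : PCTL AP)
  | conj (φ ψ : PCTL AP)
  | next (c : Comparison) (ρ : RatProb) (φ : PCTL AP)
  | untl (c : Comparison) (ρ : RatProb) (φ ψ : PCTL AP)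

/-- Paths whose second state is in `A`. -/
def nextPaths {S : Type} (A : Set S) : Set (ℕ → S) := {ω | ω 1 ∈ A}

/-- Paths that reach `B`, and stay in `A` before. -/
def untilPaths {S : Type} (A B : Set S) : Set (ℕ → S) :=
  {ω | ∃ k, ω k ∈ B ∧ ∀ j < k, ω j ∈ A}

/-- The set of the states in which a PCTL formula holds. -/
def LabelledMarkovChain.sat {S AP : Type} [MeasurableSpace S] [DiscreteMeasurableSpace S]
    [Countable S] (M : LabelledMarkovChain S AP) : PCTL AP → Set S
  | .tt => Set.univ
  | .atom a => {s | a ∈ M.label s}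
  | .neg φ => (M.sat φ)ᶜ
  | .conj φ ψ => M.sat φ ∩ M.sat ψ
  | .next c ρ φ => {s | c.holds ((M.pathMeasure s).real (nextPaths (M.sat φ))) ((ρ : ℚ) : ℝ)}
  | .untl c ρ φ ψ =>
      {s | c.holds ((M.pathMeasure s).real (untilPaths (M.sat φ) (M.sat ψ))) ((ρ : ℚ) : ℝ)}

/-! ## Probabilistic hypergraph grammars -/

/-- The set of the targets of the arcs labelled `a` with source `v`. -/
def targets {N L C V : Type} (M : Set (Hyperarc N L C V)) (v : V) (a : L) : Set V :=
  {t | Hyperarc.arc a v t ∈ M}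

/-- Probabilistic hypergraph grammars: each arc label has a probability, and at each vertex of the
generated graph there are finitely many outgoing arcs, with probabilities that sum up to `1`. -/
structure PHRGrammar extends HRGrammar where
  μ : Fin numLabels → RatProb
  finite_targets : ∀ v ∈ vertexSet toHRGrammar.graph, ∀ a, (targets toHRGrammar.graph v a).Finite
  sum_eq_one : ∀ v ∈ vertexSet toHRGrammar.graph,
    ∑ a, (μ a : ℚ) * ((targets toHRGrammar.graph v a).ncard : ℚ) = 1

namespace PHRGrammar

variable (P : PHRGrammar)

/-- The vertices of the generated graph, which are the states of the Markov chain. -/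
abbrev Vertex : Type := {v : ℕ // v ∈ vertexSet P.graph}

instance : MeasurableSpace P.Vertex := ⊤

instance : DiscreteMeasurableSpace P.Vertex := ⟨fun _ => trivial⟩

open Classical in
/-- The transition probabilities: the sum of the probabilities of the arcs from `s` to `t`. -/
noncomputable def transProb (s t : ℕ) : ℝ≥0∞ :=
  ∑ a, if t ∈ targets P.graph s a then ENNReal.ofReal ((P.μ a : ℚ) : ℝ) else 0

theorem tsum_transProb (s : P.Vertex) : ∑' t : P.Vertex, P.transProb s t = 1 := by
  classical
  have hsub : Function.support (fun t : ℕ => P.transProb s t) ⊆ vertexSet P.graph := by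
    intro t ht
    simp only [transProb, Function.mem_support, ne_eq, Finset.sum_eq_zero_iff, Finset.mem_univ,
      true_implies, not_forall] at ht
    obtain ⟨a, ha⟩ := ht
    have hm : t ∈ targets P.graph s a := by
      by_contra hc
      exact ha (if_neg hc)
    exact ⟨_, hm, by simp [Hyperarc.verts]⟩
  have h1 : ∑' t : P.Vertex, P.transProb s t = ∑' t : ℕ, P.transProb s t :=
    tsum_subtype_eq_of_support_subset (f := fun t : ℕ => P.transProb s t) hsub
  rw [h1]
  unfold transProb
  rw [Summable.tsum_finsetSum (fun _ _ => ENNReal.summable)]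
  have h2 : ∀ a, (∑' t : ℕ, if t ∈ targets P.graph (s : ℕ) a
      then ENNReal.ofReal ((P.μ a : ℚ) : ℝ) else 0) =
      ENNReal.ofReal (((P.μ a : ℚ) * ((targets P.graph (s : ℕ) a).ncard : ℚ) : ℚ) : ℝ) := by
    intro a
    have hf := P.finite_targets s s.2 a
    rw [tsum_eq_sum (s := hf.toFinset) (by intro t ht; rw [if_neg (by simpa using ht)]),
      Finset.sum_congr rfl (g := fun _ => ENNReal.ofReal ((P.μ a : ℚ) : ℝ))
        (by intro t ht; rw [if_pos (by simpa using ht)]),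
      Finset.sum_const, ← Set.ncard_eq_toFinset_card _ hf, nsmul_eq_mul]
    push_cast
    rw [ENNReal.ofReal_mul (by exact_mod_cast (P.μ a).2.1), ENNReal.ofReal_natCast, mul_comm]
  rw [Finset.sum_congr rfl (fun a _ => h2 a), ← ENNReal.ofReal_sum_of_nonneg, ← Rat.cast_sum,
    P.sum_eq_one s s.2]
  · simp
  · intro a _
    have := (P.μ a).2.1
    exact_mod_cast mul_nonneg this (Nat.cast_nonneg _)

/-- The labelled Markov chain induced by a probabilistic hypergraph grammar. Its atomic propositions
are the colours of the grammar. -/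
noncomputable def chain : LabelledMarkovChain P.Vertex (Fin P.numColours) where
  step s := ⟨fun t => P.transProb s t, (P.tsum_transProb s) ▸ ENNReal.summable.hasSum⟩
  label s := {c | Hyperarc.colour c (s : ℕ) ∈ P.graph}

end PHRGrammar

/-! ## The model-checking problem and its instances -/

/-- An instance: a probabilistic hypergraph grammar and a PCTL formula over its colours. -/
structure Instance where
  P : PHRGrammar
  φ : PCTL (Fin P.numColours)

/-- The formula holds at all vertices of the generated Markov chain. -/
def Instance.Valid (I : Instance) : Prop := ∀ v : I.P.Vertex, v ∈ I.P.chain.sat I.φ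

/-- The formula holds at some vertex of the generated Markov chain. -/
def Instance.Satisfiable (I : Instance) : Prop := ∃ v : I.P.Vertex, v ∈ I.P.chain.sat I.φ

/-- An instance together with an initial vertex `x` in the right-hand side of the start symbol; its
image in the generated graph is required to be a state of the Markov chain. -/
structure RootedInstance extends Instance where
  x : ℕ
  x_mem : x ∈ vertexSet (P.ruleGraph P.start)
  root_mem : P.derivation.rootImage x ∈ vertexSet P.graph

/-- The formula holds at the initial vertex. -/
def RootedInstance.Holds (I : RootedInstance) : Prop :=
  (⟨I.P.derivation.rootImage I.x, I.root_mem⟩ : I.P.Vertex) ∈ I.P.chain.sat I.φ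

/-! ## Encodings of the instances, and decidability -/

/-- A rational number in the unit interval is encoded by its numerator and denominator. -/
def RatProb.code (q : RatProb) : ℕ × ℕ := ((q : ℚ).num.toNat, (q : ℚ).den)

/-- A hyperarc is encoded by its kind and the list of its symbol and its vertices. -/
def Hyperarc.code {n l c : ℕ} : Hyperarc (Fin n) (Fin l) (Fin c) ℕ → ℕ × List ℕ
  | nonterm A w => (0, A.val :: w)
  | arc a s t => (1, [a.val, s, t])
  | colour d v => (2, [d.val, v])

/-- A number for each comparison symbol. -/
def Comparison.code : Comparison → ℕ
  | le => 0
  | lt => 1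
  | gt => 2
  | ge => 3

/-- The Gödel number of a PCTL formula. -/
def PCTL.code {k : ℕ} : PCTL (Fin k) → ℕ
  | tt => Nat.pair 0 0
  | atom a => Nat.pair 1 a.val
  | neg φ => Nat.pair 2 φ.code
  | conj φ ψ => Nat.pair 3 (Nat.pair φ.code ψ.code)
  | next c ρ φ => Nat.pair 4 (Nat.pair c.code (Nat.pair (Nat.pair ρ.code.1 ρ.code.2) φ.code))
  | .untl c ρ φ ψ => Nat.pair 5 (Nat.pair c.code
      (Nat.pair (Nat.pair ρ.code.1 ρ.code.2) (Nat.pair φ.code ψ.code)))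

/-- The type of the codes of grammars: the start symbol, the number of colours, the list of the
probabilities of the labels, and, for each non-terminal, its arity, its inputs and its hyperarcs. -/
abbrev GrammarCode : Type := ℕ × ℕ × List (ℕ × ℕ) × List (ℕ × List ℕ × List (ℕ × List ℕ))

/-- The code of a probabilistic hypergraph grammar. -/
def PHRGrammar.code (P : PHRGrammar) : GrammarCode :=
  (P.start.val, P.numColours, List.ofFn fun a => RatProb.code (P.μ a),
    List.ofFn fun A => (P.rank A, P.inputs A, (P.rhs A).map Hyperarc.code))

/-- The code of an instance. -/
def Instance.code (I : Instance) : GrammarCode × ℕ := (I.P.code, I.φ.code)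

/-- The code of an instance with an initial vertex. -/
def RootedInstance.code (I : RootedInstance) : (GrammarCode × ℕ) × ℕ := (I.toInstance.code, I.x)

theorem RatProb.code_injective : Function.Injective RatProb.code := by
  rintro ⟨p, hp⟩ ⟨q, hq⟩ h
  simp only [RatProb.code, Prod.mk.injEq] at h
  have h1 := Rat.num_nonneg.2 hp.1
  have h2 := Rat.num_nonneg.2 hq.1
  exact Subtype.ext (Rat.ext (by change p.num = q.num; omega) h.2)

theorem Hyperarc.code_injective {n l c : ℕ} :
    Function.Injective (Hyperarc.code (n := n) (l := l) (c := c)) := by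
  rintro (⟨A, w⟩ | ⟨a, s, t⟩ | ⟨d, v⟩) (⟨A', w'⟩ | ⟨a', s', t'⟩ | ⟨d', v'⟩) h <;>
    simp_all [Hyperarc.code, Fin.ext_iff]

theorem Comparison.code_injective : Function.Injective Comparison.code := by
  intro c d h
  cases c <;> cases d <;> simp_all [Comparison.code]

theorem PCTL.code_injective {k : ℕ} : Function.Injective (PCTL.code (k := k)) := by
  intro φ
  have hρ : ∀ ρ ρ' : RatProb, ρ.code.1 = ρ'.code.1 → ρ.code.2 = ρ'.code.2 → ρ = ρ' :=
    fun ρ ρ' h1 h2 => RatProb.code_injective (Prod.ext h1 h2)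
  induction φ with
  | tt => intro ψ h; cases ψ <;> simp_all [PCTL.code, Nat.pair_eq_pair]
  | atom a => intro ψ h; cases ψ <;> simp_all [PCTL.code, Nat.pair_eq_pair, Fin.ext_iff]
  | neg φ ih =>
    intro ψ h
    cases ψ <;> simp [PCTL.code, Nat.pair_eq_pair] at h
    rw [ih h]
  | conj φ φ' ih ih' =>
    intro ψ h
    cases ψ <;> simp [PCTL.code, Nat.pair_eq_pair] at h
    rw [ih h.1, ih' h.2]
  | next c ρ φ ih =>
    intro ψ h
    cases ψ <;> simp only [PCTL.code, Nat.pair_eq_pair] at h <;> try omega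
    obtain ⟨-, hc, hr, hφ⟩ := h
    rw [Comparison.code_injective hc, hρ _ _ hr.1 hr.2, ih hφ]
  | untl c ρ φ φ' ih ih' =>
    intro ψ h
    cases ψ <;> simp only [PCTL.code, Nat.pair_eq_pair] at h <;> try omega
    obtain ⟨-, hc, hr, hφ, hφ'⟩ := h
    rw [Comparison.code_injective hc, hρ _ _ hr.1 hr.2, ih hφ, ih' hφ']

theorem PHRGrammar.code_injective : Function.Injective PHRGrammar.code := by
  rintro ⟨⟨n, l, c, rk, s, _, r, i, _, _, _, _⟩, μ, _, _⟩
    ⟨⟨n', l', c', rk', s', _, r', i', _, _, _, _⟩, μ', _, _⟩ h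
  simp only [PHRGrammar.code, Prod.mk.injEq] at h
  obtain ⟨hs, rfl, hμ, hr⟩ := h
  have hl : l = l' := by simpa using congrArg List.length hμ
  have hn : n = n' := by simpa using congrArg List.length hr
  subst hl hn
  obtain rfl : s = s' := Fin.ext hs
  have hμ' := List.ofFn_injective hμ
  have hr' := List.ofFn_injective hr
  obtain rfl : μ = μ' := funext fun a => RatProb.code_injective (congrFun hμ' a)
  have e : ∀ A, rk A = rk' A ∧ i A = i' A ∧
      (r A).map Hyperarc.code = (r' A).map Hyperarc.code := by
    intro A
    simpa using congrFun hr' A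
  obtain rfl : rk = rk' := funext fun A => (e A).1
  obtain rfl : i = i' := funext fun A => (e A).2.1
  obtain rfl : r = r' :=
    funext fun A => (List.map_injective_iff.2 Hyperarc.code_injective) (e A).2.2
  rfl

theorem Instance.code_injective : Function.Injective Instance.code := by
  rintro ⟨P, φ⟩ ⟨P', φ'⟩ h
  simp only [Instance.code, Prod.mk.injEq] at h
  obtain ⟨hP, hφ⟩ := h
  obtain rfl := PHRGrammar.code_injective hP
  rw [PCTL.code_injective hφ]

theorem RootedInstance.code_injective : Function.Injective RootedInstance.code := by
  rintro ⟨I, x, _, _⟩ ⟨I', x', _, _⟩ h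
  simp only [RootedInstance.code, Prod.mk.injEq] at h
  obtain ⟨hI, rfl⟩ := h
  obtain rfl := Instance.code_injective hI
  rfl

/-- A decision problem, given by its instances, their codes, and a question `Q`, is decidable if
some algorithm (a partial recursive function) halts on the code of each instance and gives the right
answer. Nothing is required of the algorithm on inputs that are not codes of instances. -/
def DecidableProblem {I α : Type} [Primcodable α] (code : I → α) (Q : I → Prop) : Prop :=
  ∃ f : α →. Bool, Partrec f ∧ ∀ x : I, ∃ b, b ∈ f (code x) ∧ (b = true ↔ Q x)

end ProbHypergraph

/-!
A nondeterministic counter program searches for a halting computation. Written as a regular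
expression over increments, decrements and equality tests, it is recognised by a finite automaton,
and the grammar of the automaton generates the tree of all words over its letters. A rule sees only
the state of the automaton. The counters are not stored: they are linear in the numbers of
occurrences of the letters in the word.

PCTL can compare these numbers by means of two ladders at each word, which remove its letters one
after another. Each ladder is entered with probability `1 / 2`. An until formula can let a path fail
with probability `1 / 2` at each letter of `I` in the first ladder and succeed otherwise, and let it
succeed with probability `1 / 2` at each letter of `J` in the second ladder and fail otherwise. If
the word has `i` letters in `I` and `j` letters in `J`, then the paths succeed with probability
`(2⁻ⁱ + 1 - 2⁻ʲ) / 2`. This is `1 / 2` if and only if `i = j`, so formulae can check the tests of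
the program. For `j = 0` it is `2⁻ⁿ⁻¹` if and only if `i = n`, so the input `n` can be part of the
formula and the grammar need not depend on it.
-/

namespace ProbHypergraph

/-! ## The path measure of a Markov chain -/

namespace LabelledMarkovChain

open Preorder (frestrictLe measurable_frestrictLe)

section Paths

variable {S : Type}

/-- The cylinder of the paths that agree with `x` up to time `n`. -/
def pathCylinder (n : ℕ) (x : ℕ → S) : Set (ℕ → S) := frestrictLe n ⁻¹' {frestrictLe n x}

theorem mem_pathCylinder {n : ℕ} {x ω : ℕ → S} :
    ω ∈ pathCylinder n x ↔ ∀ i ≤ n, ω i = x i := by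
  simp [pathCylinder, funext_iff, frestrictLe]

theorem pathCylinder_succ (n : ℕ) (x : ℕ → S) :
    pathCylinder (n + 1) x =
      (fun ω : ℕ → S => (frestrictLe n ω, ω (n + 1))) ⁻¹'
        ({frestrictLe (π := fun _ => S) n x} ×ˢ {x (n + 1)}) := by
  ext ω
  have hn : frestrictLe n ω = frestrictLe n x ↔ ∀ i ≤ n, ω i = x i := mem_pathCylinder
  simp only [mem_pathCylinder, Set.mem_preimage, Set.mem_prod, Set.mem_singleton_iff, hn,
    ← Nat.lt_succ_iff]
  exact Nat.forall_lt_succ_right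

/-- The path that starts in `s` and goes on with `ω`. -/
def consPath (s : S) (ω : ℕ → S) : ℕ → S
  | 0 => s
  | n + 1 => ω n

open Classical in
theorem consPath_preimage_pathCylinder_zero (s : S) (x : ℕ → S) :
    consPath s ⁻¹' pathCylinder 0 x = if x 0 = s then Set.univ else ∅ := by
  ext ω
  split_ifs with h <;> simp [mem_pathCylinder, consPath, h, eq_comm (a := s)]

open Classical in
theorem consPath_preimage_pathCylinder_succ (s : S) (n : ℕ) (x : ℕ → S) :
    consPath s ⁻¹' pathCylinder (n + 1) x =
      if x 0 = s then pathCylinder n (fun i => x (i + 1)) else ∅ := by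
  ext ω
  have h : ω ∈ consPath s ⁻¹' pathCylinder (n + 1) x ↔ s = x 0 ∧ ∀ i ≤ n, ω i = x (i + 1) := by
    simp only [Set.mem_preimage, mem_pathCylinder, ← Nat.lt_succ_iff]
    exact Nat.forall_lt_succ_left
  split_ifs with hs <;> simp [h, hs, mem_pathCylinder, eq_comm (a := s)]

/-- From some state one can reach `B` through `A` by steps of positive probability. -/
inductive CanReach {AP : Type} (M : LabelledMarkovChain S AP) (A B : Set S) : S → Prop
  | base {s} (h : s ∈ B) : CanReach M A B s
  | step {s t} (h : s ∈ A) (hst : M.step s t ≠ 0) (ht : CanReach M A B t) : CanReach M A B s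

theorem CanReach.of_mem_untilPaths {AP : Type} {M : LabelledMarkovChain S AP}
    {A B : Set S} {ω : ℕ → S} (hω : ω ∈ untilPaths A B)
    (hstep : ∀ n, M.step (ω n) (ω (n + 1)) ≠ 0) : M.CanReach A B (ω 0) := by
  obtain ⟨k, hk, hj⟩ := hω
  induction k generalizing ω with
  | zero => exact .base hk
  | succ k ih =>
    exact .step (hj 0 k.succ_pos) (hstep 0) (ih (ω := fun n => ω (n + 1)) (fun n => hstep _) hk
      fun j hjk => hj (j + 1) (Nat.succ_lt_succ hjk))

variable [MeasurableSpace S]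

theorem measurable_consPath (s : S) : Measurable (consPath s) :=
  measurable_pi_iff.2 fun n => by
    cases n with
    | zero => exact measurable_const
    | succ n => exact measurable_pi_apply n

variable [DiscreteMeasurableSpace S]

theorem measurableSet_untilPaths (A B : Set S) : MeasurableSet (untilPaths A B) := by
  have h : untilPaths A B = ⋃ k, ((fun ω : ℕ → S => ω k) ⁻¹' B ∩
      ⋂ j ∈ Set.Iio k, (fun ω : ℕ → S => ω j) ⁻¹' A) := by
    ext ω
    simp [untilPaths]
  rw [h]
  exact .iUnion fun k => (measurable_pi_apply k .of_discrete).inter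
    (.biInter (Set.to_countable _) fun j _ => measurable_pi_apply j .of_discrete)

variable [Countable S]

theorem measurableSet_pathCylinder (n : ℕ) (x : ℕ → S) : MeasurableSet (pathCylinder n x) :=
  measurable_frestrictLe n (.singleton _)

theorem ext_of_pathCylinder {μ ν : Measure (ℕ → S)} [IsFiniteMeasure μ]
    (h : ∀ n x, μ (pathCylinder n x) = ν (pathCylinder n x)) : μ = ν := by
  have hmap : ∀ n, μ.map (frestrictLe n) = ν.map (frestrictLe n) := fun n =>
    Measure.ext_of_singleton fun y => by
      have hy : frestrictLe n (fun i => y ⟨min i n, Finset.mem_Iic.2 (min_le_right i n)⟩) = y := by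
        funext ⟨i, hi⟩
        simp [frestrictLe, min_eq_left (Finset.mem_Iic.1 hi)]
      rw [Measure.map_apply (measurable_frestrictLe n) (.singleton _),
        Measure.map_apply (measurable_frestrictLe n) (.singleton _), ← hy]
      exact h n _
  have hlim : IsProjectiveLimit ν fun I => μ.map I.restrict := by
    refine (isProjectiveLimit_nat_iff (X := fun _ => S) ?_ ν).2 fun n => (hmap n).symm
    exact isProjectiveMeasureFamily_map_restrict (X := fun i (ω : ℕ → S) => ω i) fun i =>
      (measurable_pi_apply i).aemeasurable
  exact IsProjectiveLimit.unique (P := fun I => μ.map I.restrict) (fun _ => rfl) hlim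

end Paths

section PathMeasure

variable {S AP : Type} [MeasurableSpace S] [DiscreteMeasurableSpace S] [Countable S]
  (M : LabelledMarkovChain S AP)

instance (s : S) : IsProbabilityMeasure (M.pathMeasure s) := by
  unfold pathMeasure; infer_instance

theorem pathMeasure_pathCylinder_zero (s : S) (x : ℕ → S) :
    M.pathMeasure s (pathCylinder 0 x) = Set.indicator {s} 1 (x 0) := by
  classical
  rw [pathCylinder, ← Measure.map_apply (measurable_frestrictLe 0) (.singleton _), pathMeasure,
    Kernel.traj_map_frestrictLe_apply, Kernel.partialTraj_self, Kernel.id_apply,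
    Measure.dirac_apply' _ (.singleton _)]
  simp [Set.indicator, funext_iff, frestrictLe, eq_comm]

theorem pathMeasure_pathCylinder_succ (s : S) (n : ℕ) (x : ℕ → S) :
    M.pathMeasure s (pathCylinder (n + 1) x) =
      M.pathMeasure s (pathCylinder n x) * M.step (x n) (x (n + 1)) := by
  rw [pathCylinder_succ, pathCylinder, pathMeasure,
    ← Measure.map_apply (by fun_prop) ((MeasurableSet.singleton _).prod (.singleton _)),
    ← Kernel.partialTraj_compProd_eq_map_traj zero_le, Measure.compProd_apply_prod (.singleton _)
    (.singleton _), lintegral_singleton, ← Measure.map_apply (measurable_frestrictLe n)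
    (.singleton _), Kernel.traj_map_frestrictLe_apply, mul_comm]
  congr 1
  exact PMF.toMeasure_apply_singleton _ _ (.singleton _)

theorem pathMeasure_pathCylinder (s : S) (n : ℕ) (x : ℕ → S) :
    M.pathMeasure s (pathCylinder n x) =
      Set.indicator {s} 1 (x 0) * ∏ i ∈ Finset.range n, M.step (x i) (x (i + 1)) := by
  induction n with
  | zero => rw [pathMeasure_pathCylinder_zero, Finset.prod_range_zero, mul_one]
  | succ n ih => rw [pathMeasure_pathCylinder_succ, ih, Finset.prod_range_succ, mul_assoc]

/-- The law of a path whose first state is `s` and whose second state is drawn from `M.step s`. -/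
noncomputable def firstStepMeasure (s : S) : Measure (ℕ → S) :=
  Measure.sum fun t => M.step s t • (M.pathMeasure t).map (consPath s)

theorem firstStepMeasure_apply (s : S) {A : Set (ℕ → S)} (hA : MeasurableSet A) :
    M.firstStepMeasure s A = ∑' t, M.step s t * M.pathMeasure t (consPath s ⁻¹' A) := by
  rw [firstStepMeasure, Measure.sum_apply _ hA]
  exact tsum_congr fun t => by
    rw [Measure.smul_apply, Measure.map_apply (measurable_consPath s) hA, smul_eq_mul]

theorem pathMeasure_eq_firstStepMeasure (s : S) : M.pathMeasure s = M.firstStepMeasure s := by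
  classical
  refine ext_of_pathCylinder fun n x => ?_
  rw [M.firstStepMeasure_apply s (measurableSet_pathCylinder n x)]
  by_cases hs : x 0 = s
  · cases n with
    | zero =>
      simp [consPath_preimage_pathCylinder_zero, hs, pathMeasure_pathCylinder_zero,
        (M.step s).tsum_coe]
    | succ n =>
      simp only [consPath_preimage_pathCylinder_succ, if_pos hs, pathMeasure_pathCylinder]
      rw [tsum_eq_single (x 1) fun t ht => by simp [ht.symm]]
      simp [Finset.prod_range_succ', hs, mul_comm]
  · cases n with
    | zero => simp [consPath_preimage_pathCylinder_zero, hs, pathMeasure_pathCylinder]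
    | succ n => simp [consPath_preimage_pathCylinder_succ, hs, pathMeasure_pathCylinder]

theorem pathMeasure_apply (s : S) {A : Set (ℕ → S)} (hA : MeasurableSet A) :
    M.pathMeasure s A = ∑' t, M.step s t * M.pathMeasure t (consPath s ⁻¹' A) := by
  conv_lhs => rw [pathMeasure_eq_firstStepMeasure]
  exact M.firstStepMeasure_apply s hA

theorem pathMeasure_start (s : S) : ∀ᵐ ω ∂M.pathMeasure s, ω 0 = s := by
  have h : M.pathMeasure s (pathCylinder 0 fun _ => s) = 1 := by
    simp [pathMeasure_pathCylinder_zero]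
  filter_upwards [mem_ae_iff_prob_eq_one (measurableSet_pathCylinder 0 _) |>.2 h] with ω hω
  exact mem_pathCylinder.1 hω 0 le_rfl

theorem pathMeasure_eq_one_of_forall {s : S} {A : Set (ℕ → S)}
    (h : ∀ ω : ℕ → S, ω 0 = s → ω ∈ A) : M.pathMeasure s A = 1 :=
  (measure_congr (Filter.eventuallyEq_univ.2 ((M.pathMeasure_start s).mono h))).trans measure_univ

theorem pathMeasure_eq_zero_of_forall {s : S} {A : Set (ℕ → S)}
    (h : ∀ ω : ℕ → S, ω 0 = s → ω ∉ A) : M.pathMeasure s A = 0 :=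
  measure_eq_zero_iff_ae_notMem.2 ((M.pathMeasure_start s).mono h)

theorem pathMeasure_nextPaths_ne_zero_iff {s : S} {A : Set S} :
    M.pathMeasure s (nextPaths A) ≠ 0 ↔ ∃ t, M.step s t ≠ 0 ∧ t ∈ A := by
  have hA : ∀ t, M.pathMeasure t (consPath s ⁻¹' nextPaths A) ≠ 0 ↔ t ∈ A := fun t => by
    refine ⟨fun h => ?_, fun ht => ?_⟩
    · by_contra ht
      exact h (M.pathMeasure_eq_zero_of_forall fun ω hω h1 => ht (hω ▸ h1))
    · have h1 : M.pathMeasure t (consPath s ⁻¹' nextPaths A) = 1 :=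
        M.pathMeasure_eq_one_of_forall fun ω hω => show ω 0 ∈ A from hω ▸ ht
      exact h1 ▸ one_ne_zero
  have hm : MeasurableSet (nextPaths A) := measurable_pi_apply 1 (.of_discrete (s := A))
  rw [M.pathMeasure_apply s hm, ne_eq, ENNReal.tsum_eq_zero]
  push Not
  exact exists_congr fun t => by rw [mul_ne_zero_iff, hA]

theorem pathMeasure_step_ne_zero (s : S) :
    ∀ᵐ ω ∂M.pathMeasure s, ∀ n, M.step (ω n) (ω (n + 1)) ≠ 0 := by
  refine ae_all_iff.2 fun n => ?_
  have hm : ∀ n, MeasurableSet {ω : ℕ → S | ¬ M.step (ω n) (ω (n + 1)) ≠ 0} := fun n =>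
    measurableSet_preimage
      (((measurable_pi_apply n).prodMk (measurable_pi_apply (n + 1)) :
        Measurable fun ω : ℕ → S => (ω n, ω (n + 1))))
      (.of_discrete (s := {p : S × S | ¬ M.step p.1 p.2 ≠ 0}))
  induction n generalizing s with
  | zero =>
    rw [ae_iff, M.pathMeasure_apply s (hm 0), ENNReal.tsum_eq_zero]
    refine fun t => mul_eq_zero.2 (or_iff_not_imp_left.2 fun hst => ?_)
    exact M.pathMeasure_eq_zero_of_forall fun ω hω h => h (show M.step s (ω 0) ≠ 0 from hω ▸ hst)
  | succ n ih =>
    rw [ae_iff, M.pathMeasure_apply s (hm (n + 1)), ENNReal.tsum_eq_zero]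
    exact fun t => mul_eq_zero_of_right _ (ae_iff.1 (ih t))

theorem pathMeasure_untilPaths_of_mem {A B : Set S} {s : S} (h : s ∈ B) :
    M.pathMeasure s (untilPaths A B) = 1 :=
  M.pathMeasure_eq_one_of_forall fun ω hω => ⟨0, hω ▸ h, by simp⟩

theorem pathMeasure_untilPaths_of_notMem {A B : Set S} {s : S} (hA : s ∉ A) (hB : s ∉ B) :
    M.pathMeasure s (untilPaths A B) = 0 :=
  M.pathMeasure_eq_zero_of_forall fun ω hω ⟨k, hk, hj⟩ => by
    cases k with
    | zero => exact hB (hω ▸ hk)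
    | succ k => exact hA (hω ▸ hj 0 k.succ_pos)

theorem pathMeasure_untilPaths_step {A B : Set S} {s : S} (hA : s ∈ A) (hB : s ∉ B) :
    M.pathMeasure s (untilPaths A B) =
      ∑' t, M.step s t * M.pathMeasure t (untilPaths A B) := by
  have h : consPath s ⁻¹' untilPaths A B = untilPaths A B := by
    ext ω
    refine ⟨fun ⟨k, hk, hj⟩ => ?_, fun ⟨k, hk, hj⟩ => ⟨k + 1, hk, fun j hjk => ?_⟩⟩
    · cases k with
      | zero => exact absurd hk hB
      | succ k => exact ⟨k, hk, fun j hjk => hj (j + 1) (Nat.succ_lt_succ hjk)⟩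
    · cases j with
      | zero => exact hA
      | succ j => exact hj j (Nat.lt_of_succ_lt_succ hjk)
  rw [M.pathMeasure_apply s (measurableSet_untilPaths A B), h]

theorem pathMeasure_untilPaths_ne_zero_iff {A B : Set S} {s : S} :
    M.pathMeasure s (untilPaths A B) ≠ 0 ↔ M.CanReach A B s := by
  refine ⟨fun h => ?_, fun h => ?_⟩
  · by_contra hs
    refine h (measure_eq_zero_iff_ae_notMem.2 ?_)
    filter_upwards [M.pathMeasure_start s, M.pathMeasure_step_ne_zero s] with ω h0 hstep hω
    exact hs (h0 ▸ .of_mem_untilPaths hω hstep)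
  · induction h with
    | base h => simp [M.pathMeasure_untilPaths_of_mem h]
    | @step s t h hst _ ih =>
      by_cases hB : s ∈ B
      · simp [M.pathMeasure_untilPaths_of_mem hB]
      · rw [M.pathMeasure_untilPaths_step h hB]
        exact fun h0 => mul_ne_zero hst ih (ENNReal.tsum_eq_zero.1 h0 t)

end PathMeasure

end LabelledMarkovChain

/-! ## Formulae -/

namespace PCTL

variable {AP : Type}

/-- The conjunction of a list of formulae. -/
def listConj (l : List (PCTL AP)) : PCTL AP := l.foldr .conj .tt

/-- The formula that holds where the probability of the paths of `φ U ψ` is `ρ`. -/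
def untlEq (ρ : RatProb) (φ ψ : PCTL AP) : PCTL AP := .conj (.untl .ge ρ φ ψ) (.untl .le ρ φ ψ)

end PCTL

namespace LabelledMarkovChain

variable {S AP : Type} [Countable S] [MeasurableSpace S] [DiscreteMeasurableSpace S]
  (M : LabelledMarkovChain S AP) {s : S} {φ ψ : PCTL AP} {ρ : RatProb}

theorem mem_sat_listConj {l : List (PCTL AP)} :
    s ∈ M.sat (PCTL.listConj l) ↔ ∀ φ ∈ l, s ∈ M.sat φ := by
  induction l with
  | nil => exact iff_of_true trivial (List.forall_mem_nil _)
  | cons φ l ih => rw [List.forall_mem_cons, ← ih]; rfl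

theorem mem_sat_untlEq : s ∈ M.sat (PCTL.untlEq ρ φ ψ) ↔
    (M.pathMeasure s).real (untilPaths (M.sat φ) (M.sat ψ)) = ((ρ : ℚ) : ℝ) :=
  ⟨fun h => le_antisymm h.2 h.1, fun h => ⟨h.ge, h.le⟩⟩

theorem mem_sat_next_gt_zero :
    s ∈ M.sat (.next .gt 0 φ) ↔ ∃ t, M.step s t ≠ 0 ∧ t ∈ M.sat φ := by
  rw [← pathMeasure_nextPaths_ne_zero_iff, ← measureReal_ne_zero_iff,
    ← measureReal_nonneg.lt_iff_ne']
  simp only [sat, Comparison.holds, Set.mem_ofPred_eq, gt_iff_lt, Set.Icc.coe_zero, Rat.cast_zero]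

theorem mem_sat_untl_gt_zero :
    s ∈ M.sat (.untl .gt 0 φ ψ) ↔ M.CanReach (M.sat φ) (M.sat ψ) s := by
  rw [← pathMeasure_untilPaths_ne_zero_iff, ← measureReal_ne_zero_iff,
    ← measureReal_nonneg.lt_iff_ne']
  simp only [sat, Comparison.holds, Set.mem_ofPred_eq, gt_iff_lt, Set.Icc.coe_zero, Rat.cast_zero]

end LabelledMarkovChain

/-! ## Counter programs -/

/-- The contents of the counters. -/
abbrev Counters : Type := ℕ → ℤ

/-- Counter instructions: incrementations, decrementations and tests. The counter `0` is never
decremented: `dec r` acts on the counter `r + 1`. -/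
inductive Op : Type
  | inc (r : ℕ)
  | dec (r : ℕ)
  | eq (i j : ℕ)
  | zero (r : ℕ)

namespace Op

/-- The change of the counters caused by an instruction. -/
def delta : Op → Counters
  | inc r => Pi.single r 1
  | dec r => Pi.single (r + 1) (-1)
  | eq _ _ => 0
  | zero _ => 0

/-- The linear functional of the counters that an instruction requires to vanish. -/
def test : Op → Counters →+ ℤ
  | inc _ => 0
  | dec _ => 0
  | eq i j => Pi.evalAddMonoidHom (fun _ => ℤ) i - Pi.evalAddMonoidHom (fun _ => ℤ) j
  | zero r => Pi.evalAddMonoidHom (fun _ => ℤ) r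

/-- A sequence of instructions leads from some contents of the counters to others. -/
def Exec : List Op → Counters → Counters → Prop
  | [], s, s' => s' = s
  | o :: w, s, s' => o.test s = 0 ∧ Exec w (s + o.delta) s'

theorem exec_append {u v : List Op} {s s' : Counters} :
    Exec (u ++ v) s s' ↔ ∃ t, Exec u s t ∧ Exec v t s' := by
  induction u generalizing s with
  | nil => simp [Exec]
  | cons o u ih => simp [Exec, ih, and_assoc]

theorem Exec.eq_add_sum {v : List Op} {s s' : Counters} (h : Exec v s s') :
    s' = s + (v.map delta).sum := by
  induction v generalizing s with
  | nil => exact h.trans (add_zero s).symm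
  | cons o v ih => rw [ih h.2, List.map_cons, List.sum_cons, add_assoc]

theorem test_delta_self (o : Op) : o.test o.delta = 0 := by
  cases o <;> simp [test, delta]

theorem abs_delta_sub_le (o : Op) (i j : ℕ) : |o.delta i - o.delta j| ≤ 1 := by
  cases o <;> simp only [delta, Pi.single_apply, Pi.zero_apply] <;> grind

theorem abs_delta_le (o : Op) (i : ℕ) : |o.delta i| ≤ 1 := by
  cases o <;> simp only [delta, Pi.single_apply, Pi.zero_apply] <;> grind

theorem delta_zero_nonneg (o : Op) : 0 ≤ o.delta 0 := by
  cases o <;> simp only [delta, Pi.single_apply, Pi.zero_apply] <;> grind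

theorem abs_test_delta_le (o o' : Op) : |o.test o'.delta| ≤ 1 := by
  cases o <;> simp [test, abs_delta_sub_le, abs_delta_le]

end Op

/-- Counter programs are regular expressions over instructions. -/
abbrev Program : Type := RegularExpression Op

namespace Program

open RegularExpression

/-- A program can lead from some contents of the counters to others. -/
def Rel (e : Program) (s s' : Counters) : Prop := ∃ w ∈ e.matches', Op.Exec w s s'

theorem rel_char {o : Op} {s s' : Counters} :
    Rel (char o) s s' ↔ o.test s = 0 ∧ s' = s + o.delta :=
  ⟨fun ⟨_, hw, h⟩ => by obtain rfl := Set.mem_singleton_iff.1 hw; exact h,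
    fun h => ⟨[o], rfl, h⟩⟩

theorem rel_one {s s' : Counters} : Rel 1 s s' ↔ s' = s :=
  ⟨fun ⟨_, hw, h⟩ => by obtain rfl := Set.mem_singleton_iff.1 hw; exact h, fun h => ⟨[], rfl, h⟩⟩

theorem rel_mul {e f : Program} {s s' : Counters} :
    Rel (e * f) s s' ↔ ∃ t, Rel e s t ∧ Rel f t s' := by
  simp only [Rel, matches'_mul, Language.mem_mul]
  constructor
  · rintro ⟨_, ⟨u, hu, v, hv, rfl⟩, h⟩
    obtain ⟨t, h₁, h₂⟩ := Op.exec_append.1 h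
    exact ⟨t, ⟨u, hu, h₁⟩, v, hv, h₂⟩
  · rintro ⟨t, ⟨u, hu, h₁⟩, v, hv, h₂⟩
    exact ⟨u ++ v, ⟨u, hu, v, hv, rfl⟩, Op.exec_append.2 ⟨t, h₁, h₂⟩⟩

theorem rel_star {e : Program} {s s' : Counters} :
    Rel e.star s s' ↔ Relation.ReflTransGen (Rel e) s s' := by
  simp only [Rel, matches'_star, Language.mem_kstar]
  constructor
  · rintro ⟨_, ⟨L, rfl, hL⟩, h⟩
    induction L generalizing s with
    | nil => exact (show s' = s from h) ▸ .refl
    | cons u L ih =>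
      obtain ⟨t, h₁, h₂⟩ := Op.exec_append.1 h
      obtain ⟨hu, hL⟩ := List.forall_mem_cons.1 hL
      exact .head ⟨u, hu, h₁⟩ (ih hL h₂)
  · intro h
    induction h using Relation.ReflTransGen.head_induction_on with
    | refl => exact ⟨[], ⟨[], rfl, by simp⟩, rfl⟩
    | head h₁ _ ih =>
      obtain ⟨u, hu, h₁⟩ := h₁
      obtain ⟨_, ⟨L, rfl, hL⟩, h₂⟩ := ih
      exact ⟨_, ⟨u :: L, rfl, List.forall_mem_cons.2 ⟨hu, hL⟩⟩, Op.exec_append.2 ⟨_, h₁, h₂⟩⟩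

theorem rel_star_char {o : Op} (ho : o.test = 0) {s s' : Counters} :
    Rel (char o).star s s' ↔ ∃ k : ℕ, s' = s + k • o.delta := by
  rw [rel_star]
  constructor
  · intro h
    induction h with
    | refl => exact ⟨0, by simp⟩
    | tail _ h ih =>
      obtain ⟨k, rfl⟩ := ih
      obtain ⟨-, rfl⟩ := rel_char.1 h
      exact ⟨k + 1, by rw [succ_nsmul, add_assoc]⟩
  · rintro ⟨k, rfl⟩
    induction k with
    | zero => simpa using Relation.ReflTransGen.refl
    | succ k ih => exact ih.tail (rel_char.2 ⟨by simp [ho], by rw [succ_nsmul, add_assoc]⟩)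

/-- The program that gives an arbitrary value to the counter `r + 1`. -/
def guess (r : ℕ) : Program := (char (.inc (r + 1))).star * (char (.dec r)).star

theorem rel_guess {r : ℕ} {s s' : Counters} :
    Rel (guess r) s s' ↔ ∃ x : ℤ, s' = Function.update s (r + 1) x := by
  simp only [guess, rel_mul, rel_star_char (o := .inc _) rfl, rel_star_char (o := .dec _) rfl]
  have hadd : ∀ k l : ℕ, s + k • (Op.inc (r + 1)).delta + l • (Op.dec r).delta =
      Function.update s (r + 1) (s (r + 1) + (k - l)) := fun k l => by
    ext i
    rcases eq_or_ne i (r + 1) with rfl | hi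
    · simp [Op.delta]
      ring
    · simp [Op.delta, hi]
  constructor
  · rintro ⟨_, ⟨k, rfl⟩, l, rfl⟩
    exact ⟨_, hadd k l⟩
  · rintro ⟨x, rfl⟩
    refine ⟨_, ⟨(x - s (r + 1)).toNat, rfl⟩, (s (r + 1) - x).toNat, ?_⟩
    rw [hadd]
    congr 1
    omega

/-- The program that copies the counter `j` into the counter `r + 1`. -/
def copy (r j : ℕ) : Program := guess r * char (.eq (r + 1) j)

theorem rel_copy {r j : ℕ} (h : j ≠ r + 1) {s s' : Counters} :
    Rel (copy r j) s s' ↔ s' = Function.update s (r + 1) (s j) := by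
  simp only [copy, rel_mul, rel_guess, rel_char]
  constructor
  · rintro ⟨_, ⟨x, rfl⟩, ht, rfl⟩
    obtain rfl : x = s j := by simpa [Op.test, h, sub_eq_zero] using ht
    simp [Op.delta]
  · rintro rfl
    exact ⟨_, ⟨s j, rfl⟩, by simp [Op.test, h], by simp [Op.delta]⟩

/-- The program that resets the counter `r + 1`. -/
def reset (r : ℕ) : Program := guess r * char (.zero (r + 1))

theorem rel_reset {r : ℕ} {s s' : Counters} :
    Rel (reset r) s s' ↔ s' = Function.update s (r + 1) 0 := by
  simp only [reset, rel_mul, rel_guess, rel_char]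
  constructor
  · rintro ⟨_, ⟨x, rfl⟩, ht, rfl⟩
    obtain rfl : x = 0 := by simpa [Op.test] using ht
    simp [Op.delta]
  · rintro rfl
    exact ⟨_, ⟨0, rfl⟩, by simp [Op.test], by simp [Op.delta]⟩

/-- Total correctness: the program `e` can be executed from `s`, and each execution leads to
contents of the counters that satisfy `Q`. -/
def Ensures (e : Program) (s : Counters) (Q : Counters → Prop) : Prop :=
  (∃ s', Rel e s s') ∧ ∀ s', Rel e s s' → Q s'

theorem Ensures.mul {e f : Program} {s : Counters} {Q R : Counters → Prop}
    (he : Ensures e s Q) (hf : ∀ t, Q t → Ensures f t R) : Ensures (e * f) s R := by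
  obtain ⟨⟨t, ht⟩, hQ⟩ := he
  obtain ⟨⟨s', hs'⟩, -⟩ := hf t (hQ t ht)
  refine ⟨⟨s', rel_mul.2 ⟨t, ht, hs'⟩⟩, fun s' h => ?_⟩
  obtain ⟨t, ht, hs'⟩ := rel_mul.1 h
  exact (hf t (hQ t ht)).2 s' hs'

theorem ensures_of_rel_iff {e : Program} {s t : Counters} {Q : Counters → Prop}
    (h : ∀ s', Rel e s s' ↔ s' = t) (ht : Q t) : Ensures e s Q :=
  ⟨⟨t, (h t).2 rfl⟩, fun s' hs' => (h s').1 hs' ▸ ht⟩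

theorem ensures_one {s : Counters} {Q : Counters → Prop} (h : Q s) : Ensures 1 s Q :=
  ensures_of_rel_iff (fun _ => rel_one) h

theorem ensures_copy {r j : ℕ} (hj : j ≠ r + 1) {s : Counters} {Q : Counters → Prop}
    (h : Q (Function.update s (r + 1) (s j))) : Ensures (copy r j) s Q :=
  ensures_of_rel_iff (fun _ => rel_copy hj) h

theorem ensures_reset {r : ℕ} {s : Counters} {Q : Counters → Prop}
    (h : Q (Function.update s (r + 1) 0)) : Ensures (reset r) s Q :=
  ensures_of_rel_iff (fun _ => rel_reset) h

theorem ensures_inc {r : ℕ} {s : Counters} {Q : Counters → Prop}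
    (h : Q (Function.update s r (s r + 1))) : Ensures (char (.inc r)) s Q := by
  refine ensures_of_rel_iff (fun _ => rel_char.trans (and_iff_right rfl)) ?_
  convert h using 1
  ext i
  rcases eq_or_ne i r with rfl | hi <;> simp [Op.delta, *]

theorem Ensures.loop {body : Program} {i j N : ℕ} {s : Counters} {Q : Counters → Prop}
    (I : ℕ → Counters → Prop) (init : I 0 s) (round : ∀ x t, I x t → Ensures body t (I (x + 1)))
    (count : ∀ x t, I x t → t i = x ∧ t j = N) (exit : ∀ t, I N t → Q t) :
    Ensures (body.star * char (.eq i j)) s Q := by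
  have test_iff : ∀ {x t}, I x t → ((Op.eq i j).test t = 0 ↔ x = N) := fun {x t} h => by
    simp [Op.test, count x t h, sub_eq_zero]
  have inv : ∀ t, Relation.ReflTransGen (Rel body) s t → ∃ x, I x t := fun t ht => by
    induction ht with
    | refl => exact ⟨0, init⟩
    | tail _ h ih =>
      obtain ⟨x, hx⟩ := ih
      exact ⟨x + 1, (round x _ hx).2 _ h⟩
  have reach : ∀ x, ∃ t, Relation.ReflTransGen (Rel body) s t ∧ I x t := fun x => by
    induction x with
    | zero => exact ⟨s, .refl, init⟩
    | succ x ih =>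
      obtain ⟨t, ht, hx⟩ := ih
      obtain ⟨⟨t', ht'⟩, h⟩ := round x t hx
      exact ⟨t', ht.tail ht', h t' ht'⟩
  constructor
  · obtain ⟨t, ht, hN⟩ := reach N
    exact ⟨_, rel_mul.2 ⟨t, rel_star.2 ht, rel_char.2 ⟨(test_iff hN).2 rfl, rfl⟩⟩⟩
  · intro s' h
    obtain ⟨t, ht, h⟩ := rel_mul.1 h
    obtain ⟨hN, rfl⟩ := rel_char.1 h
    obtain ⟨x, hx⟩ := inv t (rel_star.1 ht)
    obtain rfl := (test_iff hx).1 hN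
    simpa [Op.delta] using exit t hx

/-- Two contents of the counters agree up to `K`. -/
def Agree (K : ℕ) (s s' : Counters) : Prop := ∀ i ≤ K, s' i = s i

theorem Agree.refl (K : ℕ) (s : Counters) : Agree K s s := fun _ _ => rfl

theorem Agree.trans {K : ℕ} {s t u : Counters} (h : Agree K s t) (h' : Agree K t u) :
    Agree K s u := fun i hi => (h' i hi).trans (h i hi)

theorem Agree.mono {K L : ℕ} {s t : Counters} (h : Agree L s t) (hKL : K ≤ L) : Agree K s t :=
  fun i hi => h i (hi.trans hKL)

theorem Agree.update {K : ℕ} {s t : Counters} (h : Agree K s t) {r : ℕ} (hr : K < r) (x : ℤ) :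
    Agree K s (Function.update t r x) := fun i hi => by
  rw [Function.update_of_ne (hi.trans_lt hr).ne]
  exact h i hi

/-- If the counters `ρ i` contain `v`, then the program `e` writes `f v` into the counter `K + 1`,
and leaves the counters up to `K` as they are. -/
def Computes (e : Program) (K : ℕ) {n : ℕ} (ρ : Fin n → ℕ) (f : List.Vector ℕ n → ℕ) : Prop :=
  ∀ s v, (∀ i, s (ρ i) = v.get i) → Ensures e s fun s' => Agree K s s' ∧ s' (K + 1) = f v

/-- A function can be computed by counter programs, whatever the counters of its arguments. -/
def Programmable {n : ℕ} (f : List.Vector ℕ n → ℕ) : Prop :=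
  ∀ K ρ, (∀ i, ρ i ≤ K) → ∃ e, Computes e K ρ f

theorem programmable_zero : Programmable (n := 0) fun _ => 0 := fun K _ _ =>
  ⟨reset K, fun s _ _ => ensures_reset ⟨(Agree.refl K s).update K.lt_succ_self _, by simp⟩⟩

theorem programmable_get {n : ℕ} (i : Fin n) : Programmable fun v => v.get i := fun K ρ hρ =>
  ⟨copy K (ρ i), fun s v hv => ensures_copy (Nat.lt_succ_of_le (hρ i)).ne
    ⟨(Agree.refl K s).update K.lt_succ_self _, by simp [hv]⟩⟩

theorem programmable_succ : Programmable fun v : List.Vector ℕ 1 => v.head.succ := fun K ρ hρ => by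
  obtain ⟨e, he⟩ := programmable_get 0 K ρ hρ
  refine ⟨e * char (.inc (K + 1)), fun s v hv => (he s v hv).mul fun t ⟨ht, hx⟩ => ?_⟩
  exact ensures_inc ⟨ht.update K.lt_succ_self _, by simp [hx]⟩

theorem exists_computes_forall {m n : ℕ} {g : Fin n → List.Vector ℕ m → ℕ}
    (hg : ∀ i, Programmable (g i)) (K : ℕ) (ρ : Fin m → ℕ) (hρ : ∀ i, ρ i ≤ K) :
    ∃ e : Program, ∀ s v, (∀ i, s (ρ i) = v.get i) →
      Ensures e s fun s' => Agree K s s' ∧ ∀ i, s' (K + i.val + 1) = g i v := by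
  induction n with
  | zero => exact ⟨1, fun s v _ => ensures_one ⟨.refl K s, fun i => i.elim0⟩⟩
  | succ n ih =>
    obtain ⟨e, he⟩ := ih fun i => hg i.castSucc
    obtain ⟨f, hf⟩ := hg (Fin.last n) (K + n) ρ fun i => Nat.le_add_right_of_le (hρ i)
    refine ⟨e * f, fun s v hv => (he s v hv).mul fun t ⟨ht, hgt⟩ => ?_⟩
    obtain ⟨hex, h⟩ := hf t v fun i => (ht _ (hρ i)).trans (hv i)
    refine ⟨hex, fun s' hs' => ?_⟩
    obtain ⟨ht', hlast⟩ := h s' hs'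
    refine ⟨ht.trans (ht'.mono (K.le_add_right n)), fun i => ?_⟩
    cases i using Fin.lastCases with
    | last => exact hlast
    | cast i => exact (ht' _ (by simp)).trans (hgt i)

theorem programmable_comp {m n : ℕ} {f : List.Vector ℕ n → ℕ} {g : Fin n → List.Vector ℕ m → ℕ}
    (hf : Programmable f) (hg : ∀ i, Programmable (g i)) :
    Programmable fun v => f (List.Vector.ofFn fun i => g i v) := fun K ρ hρ => by
  obtain ⟨e, he⟩ := exists_computes_forall hg K ρ hρ
  obtain ⟨d, hd⟩ := hf (K + n + 1) (fun i => K + i.val + 1) fun i => by omega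
  refine ⟨e * (d * copy K (K + n + 2)), fun s v hv => (he s v hv).mul fun t ⟨ht, hgt⟩ => ?_⟩
  refine (hd t (.ofFn fun i => g i v) fun i => by simp [hgt]).mul fun u ⟨hu, hfu⟩ => ?_
  exact ensures_copy (by omega) ⟨(ht.trans (hu.mono (by omega))).update K.lt_succ_self _, by
    simpa using hfu⟩

theorem programmable_prec {n : ℕ} {f : List.Vector ℕ n → ℕ} {g : List.Vector ℕ (n + 2) → ℕ}
    (hf : Programmable f) (hg : Programmable g) :
    Programmable fun v : List.Vector ℕ (n + 1) =>
      v.head.rec (f v.tail) fun y IH => g (y ::ᵥ IH ::ᵥ v.tail) := fun K ρ hρ => by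
  obtain ⟨d, hd⟩ := hf K (fun i => ρ i.succ) fun i => hρ _
  obtain ⟨e, he⟩ := hg (K + 2) (Fin.cons (K + 2) (Fin.cons (K + 1) fun i => ρ i.succ))
    (Fin.cases le_rfl (Fin.cases (Nat.le_succ _) fun i => Nat.le_add_right_of_le (hρ _)))
  refine ⟨d * (reset (K + 1) *
    ((e * (copy K (K + 3) * char (Op.inc (K + 2)))).star * char (Op.eq (K + 2) (ρ 0)))),
    fun s v hv => ?_⟩
  let F : ℕ → ℕ := fun x => x.rec (f v.tail) fun y IH => g (y ::ᵥ IH ::ᵥ v.tail)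
  let I (x : ℕ) (t : Counters) : Prop := Agree K s t ∧ t (K + 1) = Nat.cast (F x) ∧ t (K + 2) = x
  have round : ∀ x t, I x t →
      Ensures (e * (copy K (K + 3) * char (Op.inc (K + 2)))) t (I (x + 1)) := by
    rintro x t ⟨hst, hF, hx⟩
    have call := he t (x ::ᵥ F x ::ᵥ v.tail)
      (Fin.cases hx (Fin.cases hF fun i => by simp [hst _ (hρ _), hv]))
    refine call.mul fun u ⟨htu, hgu⟩ => (ensures_copy
      (Q := (· = Function.update u (K + 1) (u (K + 3)))) (by simp) rfl).mul ?_
    rintro _ rfl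
    have hsu : Agree K s u := hst.trans (htu.mono (by simp))
    refine ensures_inc ⟨(hsu.update (by simp) _).update (by simp) _, ?_, ?_⟩
    · simpa using hgu
    · simp [htu _ le_rfl, hx]
  refine (hd s v.tail fun i => by simp [hv]).mul fun t ⟨hst, hft⟩ => ?_
  refine (ensures_reset (Q := I 0) ⟨hst.update (by simp) 0, by simpa [F] using hft, by simp⟩).mul ?_
  refine fun t₀ h₀ => .loop I h₀ round (N := v.head) (fun x t h => ⟨h.2.2, ?_⟩)
    fun t h => ⟨h.1, h.2.1⟩
  rw [h.1 _ (hρ 0), hv 0, List.Vector.get_zero]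

theorem programmable_of_primrec' {n : ℕ} {f : List.Vector ℕ n → ℕ} (hf : Nat.Primrec' f) :
    Programmable f := by
  induction hf with
  | zero => exact programmable_zero
  | succ => exact programmable_succ
  | get i => exact programmable_get i
  | comp _ _ _ hf hg => exact programmable_comp hf hg
  | prec _ _ hf hg => exact programmable_prec hf hg

theorem exists_program {f : ℕ → ℕ → ℕ} (hf : Primrec₂ f) :
    ∃ e : Program, ∀ n : ℕ, (∃ k, f k n = 0) ↔ ∃ s', Rel e 0 s' ∧ s' 0 = n := by
  obtain ⟨e, he⟩ := programmable_of_primrec' (Nat.Primrec'.prim_iff₂.2 hf) 1 ![1, 0]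
    (by simp [Fin.forall_fin_two])
  let init (n k : ℕ) : Counters := 0 + n • (Op.inc 0).delta + k • (Op.inc 1).delta
  have hinit : ∀ n k, Ensures e (init n k) fun s' => s' 0 = n ∧ s' 2 = f k n := fun n k => by
    obtain ⟨hex, h⟩ := he (init n k) (k ::ᵥ n ::ᵥ .nil) (by
      simp [Fin.forall_fin_two, init, Op.delta]
      rfl)
    refine ⟨hex, fun s' hs' => ⟨?_, by simpa using (h s' hs').2⟩⟩
    simpa [init, Op.delta] using (h s' hs').1 0 zero_le_one
  refine ⟨(char (.inc 0)).star * ((char (.inc 1)).star * (e * char (.zero 2))), fun n => ?_⟩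
  simp only [rel_mul, rel_star_char (o := .inc _) rfl, rel_char]
  constructor
  · rintro ⟨k, hk⟩
    obtain ⟨⟨s', hs'⟩, h⟩ := hinit n k
    refine ⟨s', ⟨_, ⟨n, rfl⟩, _, ⟨k, rfl⟩, s', hs', ?_, by simp [Op.delta]⟩, (h s' hs').1⟩
    simp [Op.test, (h s' hs').2, hk]
  · rintro ⟨_, ⟨_, ⟨m, rfl⟩, _, ⟨k, rfl⟩, s', hs', hz, rfl⟩, hn⟩
    obtain ⟨h0, h2⟩ := (hinit m k).2 s' hs'
    have hz : f k m = 0 := by simpa [Op.test, h2] using hz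
    have hmn : m = n := by simpa [Op.delta, h0] using hn
    exact ⟨k, hmn ▸ hz⟩

end Program

/-! ## Automata for regular expressions -/

section Regular

open Computability Language

variable {α : Type}

theorem isRegular_of_mem_finite {𝓕 : Set (Language α)} (h𝓕 : 𝓕.Finite)
    (closed : ∀ A ∈ 𝓕, ∀ a, A.leftQuotient [a] ∈ 𝓕) {L : Language α} (hL : L ∈ 𝓕) :
    L.IsRegular := by
  refine IsRegular.of_finite_range_leftQuotient (h𝓕.subset (Set.range_subset_iff.2 fun x => ?_))
  induction x using List.reverseRecOn with
  | nil => exact hL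
  | append_singleton x a ih => exact leftQuotient_append L x [a] ▸ closed _ ih a

theorem leftQuotient_mem_range {L A : Language α} (hA : A ∈ Set.range L.leftQuotient) (a : α) :
    A.leftQuotient [a] ∈ Set.range L.leftQuotient := by
  obtain ⟨x, rfl⟩ := hA
  exact ⟨x ++ [a], leftQuotient_append L x [a]⟩

theorem mem_sSup_iff {S : Set (Language α)} {u : List α} : u ∈ sSup S ↔ ∃ A ∈ S, u ∈ A := Iff.rfl

theorem cons_mem_mul {L M : Language α} {a : α} {u : List α} :
    a :: u ∈ L * M ↔ u ∈ L.leftQuotient [a] * M ∨ [] ∈ L ∧ a :: u ∈ M := by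
  simp only [mem_mul, mem_leftQuotient, List.singleton_append]
  constructor
  · rintro ⟨_ | ⟨b, v⟩, hv, w, hw, h⟩
    · exact .inr ⟨hv, h ▸ hw⟩
    · obtain ⟨rfl, rfl⟩ := List.cons_eq_cons.1 h
      exact .inl ⟨v, hv, w, hw, rfl⟩
  · rintro (⟨v, hv, w, hw, rfl⟩ | ⟨hL, hM⟩)
    · exact ⟨a :: v, hv, w, hw, rfl⟩
    · exact ⟨[], hL, a :: u, hM, rfl⟩

theorem cons_mem_kstar {L : Language α} {a : α} {u : List α} :
    a :: u ∈ L∗ ↔ u ∈ L.leftQuotient [a] * L∗ := by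
  constructor
  · rw [mem_kstar_iff_exists_nonempty]
    rintro ⟨_ | ⟨_ | ⟨b, v⟩, S⟩, h, hS⟩
    · exact absurd h (List.cons_ne_nil a u)
    · exact absurd rfl (hS [] List.mem_cons_self).2
    · obtain ⟨rfl, rfl⟩ := List.cons_eq_cons.1 h
      exact append_mem_mul (hS _ List.mem_cons_self).1
        (join_mem_kstar fun y hy => (hS y (List.mem_cons_of_mem _ hy)).1)
  · rintro ⟨v, hv, _, ⟨S, rfl, hS⟩, rfl⟩
    exact ⟨(a :: v) :: S, rfl, List.forall_mem_cons.2 ⟨hv, hS⟩⟩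

theorem isRegular_mul {L M : Language α} (hL : L.IsRegular) (hM : M.IsRegular) :
    (L * M).IsRegular := by
  refine isRegular_of_mem_finite (hL.finite_range_leftQuotient.image2 (fun A S => A * M + sSup S)
    hM.finite_range_leftQuotient.finite_subsets) ?_ ⟨L, ⟨[], rfl⟩, ∅, by simp, ?_⟩
  · rintro _ ⟨A, hA, S, hS, rfl⟩ a
    refine ⟨_, leftQuotient_mem_range hA a,
      {N | ∃ T ∈ S, N = T.leftQuotient [a]} ∪ {N | [] ∈ A ∧ N = M.leftQuotient [a]}, ?_, ?_⟩
    · rintro _ (⟨T, hT, rfl⟩ | ⟨-, rfl⟩)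
      · exact leftQuotient_mem_range (hS hT) a
      · exact ⟨[a], rfl⟩
    · ext u
      simp only [mem_add, mem_leftQuotient, List.singleton_append, cons_mem_mul, mem_sSup_iff,
        Set.mem_union, Set.mem_ofPred_eq]
      grind [mem_leftQuotient, List.singleton_append]
  · ext u
    simp

theorem isRegular_kstar {L : Language α} (hL : L.IsRegular) : (L∗).IsRegular := by
  refine isRegular_of_mem_finite ((hL.finite_range_leftQuotient.finite_subsets.image
    fun S => sSup S * L∗).insert (L∗)) ?_ (Set.mem_insert _ _)
  rintro _ (rfl | ⟨S, hS, rfl⟩) a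
  · refine .inr ⟨{L.leftQuotient [a]}, by simp, ?_⟩
    ext u
    simp [cons_mem_kstar]
  · refine .inr ⟨{N | ∃ T ∈ S, N = T.leftQuotient [a]} ∪ {N | [] ∈ sSup S ∧ N = L.leftQuotient [a]},
      ?_, ?_⟩
    · rintro _ (⟨T, hT, rfl⟩ | ⟨-, rfl⟩)
      · exact leftQuotient_mem_range (hS hT) a
      · exact ⟨[a], rfl⟩
    · ext u
      rw [mem_leftQuotient, List.singleton_append, cons_mem_mul, cons_mem_kstar]
      simp only [mem_mul, mem_sSup_iff, mem_leftQuotient, List.singleton_append, Set.mem_union,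
        Set.mem_ofPred_eq]
      grind [mem_leftQuotient, List.singleton_append]

theorem isRegular_zero : (0 : Language α).IsRegular :=
  isRegular_of_mem_finite (Set.finite_singleton 0) (by rintro _ rfl _; rfl) rfl

theorem isRegular_one : (1 : Language α).IsRegular :=
  kstar_zero (α := Language α) ▸ isRegular_kstar isRegular_zero

theorem isRegular_singleton (a : α) : ({[a]} : Language α).IsRegular := by
  classical
  refine isRegular_of_mem_finite (𝓕 := {{[a]}, 1, 0}) (Set.toFinite _) ?_ (.inl rfl)
  rintro _ (rfl | rfl | rfl) b
  · rcases eq_or_ne b a with rfl | hb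
    · exact .inr (.inl (by ext u; exact List.cons_eq_cons.trans (and_iff_right rfl)))
    · exact .inr (.inr (by ext u; exact iff_of_false (fun h => hb (List.cons_eq_cons.1 h).1) id))
  · exact .inr (.inr (by ext u; simp))
  · exact .inr (.inr rfl)

theorem isRegular_matches' (e : RegularExpression α) : e.matches'.IsRegular := by
  induction e with
  | zero => exact isRegular_zero
  | epsilon => exact isRegular_one
  | char a => exact isRegular_singleton a
  | plus e f ihe ihf => exact ihe.add ihf
  | comp e f ihe ihf => exact isRegular_mul ihe ihf
  | star e ih => exact isRegular_kstar ih

theorem exists_finite_alphabet (e : RegularExpression α) :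
    ∃ F : Set α, F.Finite ∧ ∀ w ∈ e.matches', ∀ a ∈ w, a ∈ F := by
  induction e with
  | zero => exact ⟨∅, Set.finite_empty, fun _ hw => hw.elim⟩
  | epsilon =>
    exact ⟨∅, Set.finite_empty, fun w hw => by obtain rfl : w = [] := hw; simp⟩
  | char a =>
    exact ⟨{a}, Set.finite_singleton a, fun w hw => by obtain rfl : w = [a] := hw; simp⟩
  | plus e f ihe ihf =>
    obtain ⟨⟨E, hE, hE'⟩, F, hF, hF'⟩ := ihe, ihf
    exact ⟨E ∪ F, hE.union hF, fun w hw a ha =>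
      hw.imp (fun hw => hE' w hw a ha) fun hw => hF' w hw a ha⟩
  | comp e f ihe ihf =>
    obtain ⟨⟨E, hE, hE'⟩, F, hF, hF'⟩ := ihe, ihf
    refine ⟨E ∪ F, hE.union hF, ?_⟩
    rintro _ ⟨u, hu, v, hv, rfl⟩ a ha
    exact (List.mem_append.1 ha).imp (hE' u hu a) (hF' v hv a)
  | star e ih =>
    obtain ⟨E, hE, hE'⟩ := ih
    refine ⟨E, hE, ?_⟩
    rintro _ ⟨S, rfl, hS⟩ a ha
    obtain ⟨u, hu, ha⟩ := List.mem_flatten.1 ha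
    exact hE' u (hS u hu) a ha

theorem exists_dfa (e : RegularExpression α) :
    ∃ (k : ℕ) (f : Fin k → α) (m : ℕ) (D : DFA (Fin k) (Fin m)),
      ∀ w, w ∈ e.matches' ↔ ∃ v : List (Fin k), v ∈ D.accepts ∧ v.map f = w := by
  obtain ⟨F, hF, hFe⟩ := exists_finite_alphabet e
  obtain ⟨σ, _, M, hM⟩ := isRegular_matches' e
  have := hF.fintype
  let f : Fin (Fintype.card F) → α := fun i => (Fintype.equivFin F).symm i
  refine ⟨_, f, _, DFA.reindex (Fintype.equivFin σ) (M.comap f), fun w => ?_⟩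
  rw [DFA.accepts_reindex, DFA.accepts_comap, hM]
  refine ⟨fun hw => ?_, fun ⟨_, hv, h⟩ => h ▸ hv⟩
  obtain ⟨v, rfl⟩ : ∃ v, v.map f = w := ⟨w.attach.map fun a =>
    Fintype.equivFin F ⟨a.1, hFe w hw a.1 a.2⟩, by simp [f, Function.comp_def]⟩
  exact ⟨v, hw, rfl⟩

end Regular

/-! ## Derivations -/

theorem Hyperarc.isTerminal_map {N L C V W : Type} {f : V → W} {e : Hyperarc N L C V} :
    (e.map f).IsTerminal ↔ e.IsTerminal := by
  cases e <;> exact Iff.rfl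

theorem Hyperarc.map_map {N L C U V W : Type} (f : U → V) (g : V → W) (e : Hyperarc N L C U) :
    (e.map f).map g = e.map (g ∘ f) := by
  cases e <;> simp [Hyperarc.map]

namespace HRGrammar.Derivation

variable {G : HRGrammar} (D : G.Derivation) {n m : ℕ} {A B : Fin G.numNonterm} {u w : List ℕ}

theorem nonterm_mem_zero : .nonterm A w ∈ D.H 0 ↔ A = G.start ∧ w = [] := by
  simp [D.H_zero, startGraph]

theorem nonterm_mem_succ : .nonterm B u ∈ D.H (n + 1) ↔ ∃ A w, .nonterm A w ∈ D.H n ∧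
    ∃ v, .nonterm B v ∈ G.rhs A ∧ v.map (D.h n A w) = u := by
  rw [(D.step n).result]
  constructor
  · rintro (⟨-, h⟩ | ⟨A, w, hAw, ⟨_, v⟩ | _ | _, hr, he⟩)
    · exact h.elim
    · obtain ⟨rfl, rfl⟩ := Hyperarc.nonterm.inj he
      exact ⟨A, w, hAw, v, hr, rfl⟩
    all_goals exact nomatch he
  · rintro ⟨A, w, hAw, v, hv, rfl⟩
    exact .inr ⟨A, w, hAw, _, hv, rfl⟩

theorem map_mem_succ (hA : .nonterm A w ∈ D.H n) {e} (he : e ∈ G.rhs A) :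
    e.map (D.h n A w) ∈ D.H (n + 1) :=
  (D.step n).result ▸ .inr ⟨A, w, hA, e, he, rfl⟩

theorem mem_graph {r} : r ∈ D.graph ↔ ∃ n A w, .nonterm A w ∈ D.H n ∧
    ∃ e ∈ G.rhs A, e.IsTerminal ∧ r = e.map (D.h n A w) := by
  constructor
  · rw [graph, Set.mem_iUnion]
    rintro ⟨n, hr, ht⟩
    induction n with
    | zero =>
      rw [D.H_zero] at hr
      exact absurd ht (hr ▸ id)
    | succ n ih =>
      rw [(D.step n).result] at hr
      obtain hr | ⟨A, w, hAw, e, he, rfl⟩ := hr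
      · exact ih hr.1
      · exact ⟨n, A, w, hAw, e, he, Hyperarc.isTerminal_map.1 ht, rfl⟩
  · rintro ⟨n, A, w, hAw, e, he, ht, rfl⟩
    exact Set.mem_iUnion.2 ⟨n + 1, D.map_mem_succ hAw he, Hyperarc.isTerminal_map.2 ht⟩

theorem apply_mem_vertexSet_succ (hA : .nonterm A w ∈ D.H n) {x : ℕ}
    (hx : x ∈ vertexSet (G.ruleGraph A)) : D.h n A w x ∈ vertexSet (D.H (n + 1)) := by
  obtain ⟨e, he, hxe⟩ := hx
  exact ⟨_, D.map_mem_succ hA he, mem_verts_map _ e ▸ List.mem_map_of_mem hxe⟩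

theorem monotone_vertexSet : Monotone fun n => vertexSet (D.H n) := by
  refine monotone_nat_of_le_succ fun n v ⟨e, he, hv⟩ => ?_
  by_cases ht : e.IsTerminal
  · exact ⟨e, (D.step n).result ▸ .inl ⟨he, ht⟩, hv⟩
  · obtain ⟨A, w⟩ | _ | _ := e
    · obtain ⟨x, hx, rfl⟩ := List.mem_map.1 ((D.step n).map_inputs A w he ▸ hv)
      exact D.apply_mem_vertexSet_succ he (G.inputs_mem A x hx)
    all_goals exact absurd trivial ht

theorem apply_ne_apply_of_lt (hnm : n < m) (hA : .nonterm A w ∈ D.H n)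
    (hB : .nonterm B u ∈ D.H m) {x y : ℕ} (hx : x ∈ G.newVertices A) (hy : y ∈ G.newVertices B) :
    D.h n A w x ≠ D.h m B u y := fun h =>
  (D.step m).fresh B u hB y hy
    (h ▸ D.monotone_vertexSet hnm (D.apply_mem_vertexSet_succ hA hx.1))

theorem apply_inj (hA : .nonterm A w ∈ D.H n) (hB : .nonterm B u ∈ D.H m) {x y : ℕ}
    (hx : x ∈ G.newVertices A) (hy : y ∈ G.newVertices B) (h : D.h n A w x = D.h m B u y) :
    n = m ∧ A = B ∧ w = u ∧ x = y := by
  obtain hlt | rfl | hlt := lt_trichotomy n m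
  · exact absurd h (D.apply_ne_apply_of_lt hlt hA hB hx hy)
  · by_cases hne : (A, w) = (B, u)
    · obtain ⟨rfl, rfl⟩ := Prod.mk.inj hne
      exact ⟨rfl, rfl, rfl, (D.step n).injOn A w hA hx.1 hy.1 h⟩
    · exact absurd h ((D.step n).disjoint A w hA B u hB hne x hx y hy)
  · exact absurd h.symm (D.apply_ne_apply_of_lt hlt hB hA hy hx)

end HRGrammar.Derivation

/-! ## The tree of words with ladders -/

/-- The states of the Markov chain over the words in the alphabet `Fin k`, where the word of a
sequence of letters lists the last letter first. From `main w` the chain extends `w` by a letter or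
enters `test w`; from there it moves with probability `1 / 2` to each of the two copies
`down true w` and `down false w` of a ladder, which removes the letters of `w` one after another.
At each letter `a`, the ladder passes through `mark b a w` with probability `1 / 2`. -/
inductive Node (k : ℕ) : Type
  | main (w : List (Fin k))
  | test (w : List (Fin k))
  | down (b : Bool) (w : List (Fin k))
  | mark (b : Bool) (a : Fin k) (w : List (Fin k))
  deriving DecidableEq, Encodable

/-- The colours of the nodes: `root` for the empty word, `acc` for the accepted words, `letter a`
for the words with last letter `a`, `halt b` for the end of a ladder. -/
inductive Colour (k : ℕ) : Type
  | root
  | acc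
  | test
  | letter (a : Fin k)
  | mark (b : Bool) (a : Fin k)
  | halt (b : Bool)
  deriving DecidableEq, Fintype

namespace Node

variable {k : ℕ}

/-- The targets of the arcs that leave a node. -/
def succs : Node k → Finset (Node k)
  | main w => insert (test w) (Finset.univ.image fun a => main (a :: w))
  | test w => {down true w, down false w}
  | down b [] => {down b []}
  | down b (a :: w) => {down b w, mark b a w}
  | mark b _ w => {down b w}

/-- The label of the arcs that leave a node: it determines their number, hence their
probability. -/
def label : Node k → Fin 3
  | main _ => 0
  | test _ => 1
  | down _ [] => 2
  | down _ (_ :: _) => 1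
  | mark _ _ _ => 2

/-- The probabilities of the labels. -/
def weight (k : ℕ) : Fin 3 → ℚ := ![1 / (k + 1), 1 / 2, 1]

theorem weight_nonneg (l : Fin 3) : 0 ≤ weight k l := by
  fin_cases l
  · exact one_div_nonneg.2 (by positivity)
  all_goals norm_num [weight]

theorem weight_mul_card_succs (u : Node k) : weight k u.label * u.succs.card = 1 := by
  rcases u with w | w | ⟨b, _ | ⟨a, w⟩⟩ | ⟨b, a, w⟩
  · have hcard : (main w).succs.card = k + 1 := by
      rw [succs, Finset.card_insert_of_notMem (by simp),
        Finset.card_image_of_injective _ fun a b h => by simpa using h, Finset.card_univ,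
        Fintype.card_fin]
    rw [hcard]
    simp only [weight, label, Matrix.cons_val_zero, Nat.cast_succ]
    exact one_div_mul_cancel (by positivity)
  all_goals simp [weight, label, succs]

theorem weight_le_one (l : Fin 3) : weight k l ≤ 1 := by
  fin_cases l
  · exact div_le_one_of_le₀ (by simp) (by positivity)
  all_goals norm_num [weight]

/-- The nodes of a word that the rule of its last letter shares with the rules of its
extensions. -/
def ports (w : List (Fin k)) : List (Node k) := [main w, down true w, down false w]

/-- The node in the tree above `v` that corresponds to a node in the whole tree. -/
def shift (v : List (Fin k)) : Node k → Node k
  | main w => main (w ++ v)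
  | test w => test (w ++ v)
  | down b w => down b (w ++ v)
  | mark b a w => mark b a (w ++ v)

end Node

/-- The symbol of a colour. -/
noncomputable def Colour.idx {k : ℕ} (c : Colour k) : Fin (Fintype.card (Colour k)) :=
  Fintype.equivFin _ c

theorem Colour.idx_injective {k : ℕ} : Function.Injective (Colour.idx (k := k)) :=
  (Fintype.equivFin _).injective

namespace Automaton

open Node

variable {k m : ℕ} (D : DFA (Fin k) (Fin m))

open Classical in
/-- The colours of a node in the tree above a word that leads the automaton to the state `q`. -/
noncomputable def colours (q : Fin m) : Node k → List (Colour k)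
  | main w => w.head?.elim .root .letter ::
      if D.evalFrom q w.reverse ∈ D.accept then [.acc] else []
  | test _ => [.test]
  | down b [] => [.halt b]
  | down _ (_ :: _) => []
  | mark b a _ => [.mark b a]

/-- Hyperarcs between nodes. The non-terminal `q.succ` generates the tree above a word that leads
the automaton to the state `q`, and `0` is the start symbol. -/
abbrev NodeArc (k m : ℕ) : Type :=
  Hyperarc (Fin (m + 1)) (Fin 3) (Fin (Fintype.card (Colour k))) (Node k)

/-- The nodes of the right-hand side of a non-terminal that are its inputs. -/
def inputNodes : Fin (m + 1) → List (Node k) :=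
  Fin.cases [] fun _ => ports []

/-- The nodes that are created by the right-hand side of a non-terminal. -/
def born : Fin (m + 1) → List (Node k) :=
  Fin.cases [main [], down true [], down false []] fun _ => test [] :: (List.finRange k).flatMap
    fun a => [main [a], down true [a], down false [a], mark true a [], mark false a []]

/-- The nodes whose outgoing arcs belong to the right-hand side of a non-terminal. -/
def sources : Fin (m + 1) → List (Node k) :=
  Fin.cases [down true [], down false []] fun _ => main [] :: test [] :: (List.finRange k).flatMap
    fun a => [down true [a], down false [a], mark true a [], mark false a []]

/-- The non-terminal hyperarcs of the right-hand side of a non-terminal: `(r, w)` stands for the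
non-terminal of the state `r` at the ports of `w`. -/
def calls : Fin (m + 1) → List (Fin m × List (Fin k)) :=
  Fin.cases [(D.start, [])] fun q => (List.finRange k).map fun a => (D.step q a, [a])

/-- The right-hand side of a non-terminal. -/
noncomputable def rule (A : Fin (m + 1)) : List (NodeArc k m) :=
  (sources A).flatMap (fun u => u.succs.toList.map fun v => .arc u.label u v) ++
    (born A).flatMap (fun u => (colours D (Fin.cases D.start id A) u).map fun c =>
      .colour c.idx u) ++
    (calls D A).map fun p => .nonterm p.1.succ (ports p.2)

variable {D} {A : Fin (m + 1)}

theorem arc_mem_rule {l : Fin 3} {u v : Node k} :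
    .arc l u v ∈ rule D A ↔ u ∈ sources A ∧ v ∈ u.succs ∧ l = u.label := by
  simp only [rule, List.append_assoc, List.mem_append, List.mem_flatMap, List.mem_map,
    Finset.mem_toList, Hyperarc.arc.injEq, ↓existsAndEq, and_true, reduceCtorEq, and_false,
    exists_false, or_self, or_false, and_congr_right_iff]
  grind

theorem colour_mem_rule {c : Fin (Fintype.card (Colour k))} {u : Node k} :
    .colour c u ∈ rule D A ↔
      u ∈ born A ∧ ∃ d ∈ colours D (Fin.cases D.start id A) u, d.idx = c := by
  simp [rule]

theorem nonterm_mem_rule {B : Fin (m + 1)} {v : List (Node k)} :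
    .nonterm B v ∈ rule D A ↔ ∃ p ∈ calls D A, p.1.succ = B ∧ ports p.2 = v := by
  simp [rule]

theorem nodup_ports (w : List (Fin k)) : (ports w).Nodup := by
  simp [ports]

theorem succs_nonempty (u : Node k) : u.succs.Nonempty := by
  rw [Finset.nonempty_iff_ne_empty]
  rintro h
  simpa [h] using weight_mul_card_succs u

theorem disjoint_inputNodes_born : (inputNodes A : List (Node k)).Disjoint (born A) := by
  cases A using Fin.cases <;> simp [inputNodes, born, ports, List.Disjoint]

theorem exists_mem_verts_of_mem_sources {u : Node k} (hu : u ∈ sources A) :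
    ∃ e ∈ rule D A, e.IsTerminal ∧ u ∈ e.verts := by
  obtain ⟨v, hv⟩ := succs_nonempty u
  exact ⟨.arc u.label u v, arc_mem_rule.2 ⟨hu, hv, rfl⟩, trivial, List.mem_cons_self⟩

theorem exists_mem_verts_of_mem_born {u : Node k} (hu : u ∈ born A) :
    ∃ e ∈ rule D A, e.IsTerminal ∧ u ∈ e.verts := by
  by_cases hs : u ∈ sources A
  · exact exists_mem_verts_of_mem_sources hs
  obtain ⟨c, hc⟩ : ∃ c, c ∈ colours D (Fin.cases D.start id A) u := by
    refine List.exists_mem_of_ne_nil _ ?_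
    cases A using Fin.cases <;>
      simp only [born, sources, Fin.cases_zero, Fin.cases_succ] at hu hs <;>
      rcases u with w | w | ⟨b, _ | ⟨a, w⟩⟩ | ⟨b, a, w⟩ <;> simp_all [colours]
  exact ⟨.colour c.idx u, colour_mem_rule.2 ⟨hu, c, hc, rfl⟩, trivial, List.mem_cons_self⟩

theorem exists_mem_verts_of_mem_inputNodes {u : Node k} (hu : u ∈ inputNodes A) :
    ∃ e ∈ rule D A, u ∈ e.verts := by
  cases A using Fin.cases with
  | zero => simp [inputNodes] at hu
  | succ q =>
    suffices ∃ v ∈ sources q.succ, u = v ∨ u ∈ v.succs by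
      obtain ⟨v, hv, rfl | huv⟩ := this
      · obtain ⟨e, he, -, hue⟩ := exists_mem_verts_of_mem_sources hv
        exact ⟨e, he, hue⟩
      · exact ⟨.arc v.label v u, arc_mem_rule.2 ⟨hv, huv, rfl⟩, by simp [Hyperarc.verts]⟩
    simp only [inputNodes, Fin.cases_succ, ports, List.mem_cons, List.not_mem_nil, or_false] at hu
    obtain rfl | hu := hu
    · exact ⟨main [], by simp [sources], .inl rfl⟩
    · exact ⟨test [], by simp [sources], .inr (by simpa [succs] using hu)⟩

theorem mem_inputNodes_or_mem_born_of_mem_sources {u : Node k} (hu : u ∈ sources A) :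
    u ∈ inputNodes A ∨ u ∈ born A := by
  cases A using Fin.cases <;>
    grind [sources, inputNodes, born, ports]

theorem mem_inputNodes_or_mem_born_of_mem_succs {u v : Node k} (hu : u ∈ sources A)
    (hv : v ∈ u.succs) : v ∈ inputNodes A ∨ v ∈ born A := by
  cases A using Fin.cases <;>
    simp only [sources, inputNodes, born, ports, Fin.cases_zero, Fin.cases_succ, List.mem_cons,
      List.mem_flatMap, List.mem_finRange, true_and] at hu ⊢ <;>
    grind [succs]

variable (D)

/-- The hypergraph grammar of an automaton: its non-terminals are a start symbol and the states. -/
noncomputable abbrev hrGrammar : HRGrammar where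
  numNonterm := m + 1
  numLabels := 3
  numColours := Fintype.card (Colour k)
  rank := Fin.cases 0 fun _ => 3
  start := 0
  rank_start := rfl
  rhs A := (rule D A).map (Hyperarc.map Encodable.encode)
  inputs A := (inputNodes A : List (Node k)).map Encodable.encode
  length_inputs A := by cases A using Fin.cases <;> simp [inputNodes, ports]
  nodup_inputs A := by
    cases A using Fin.cases <;>
      simp [inputNodes, nodup_ports, List.nodup_map_iff Encodable.encode_injective]
  inputs_mem A x hx := by
    obtain ⟨u, hu, rfl⟩ := List.mem_map.1 hx
    obtain ⟨e, he, hue⟩ := exists_mem_verts_of_mem_inputNodes hu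
    exact ⟨_, List.mem_map_of_mem he, HRGrammar.mem_verts_map _ e ▸ List.mem_map_of_mem hue⟩
  rhs_wf A B w hw := by
    obtain ⟨_ | _ | _, he, h⟩ := List.mem_map.1 hw
    · obtain ⟨rfl, rfl⟩ := Hyperarc.nonterm.inj h
      obtain ⟨p, -, rfl, rfl⟩ := nonterm_mem_rule.1 he
      exact ⟨by simp [ports], by simp [ports],
        (nodup_ports _).map Encodable.encode_injective⟩
    all_goals exact nomatch h

variable {D}

theorem encode_mem_newVertices {u : Node k} (hu : u ∈ born A) :
    Encodable.encode u ∈ (hrGrammar D).newVertices A := by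
  constructor
  · obtain ⟨e, he, -, hue⟩ := exists_mem_verts_of_mem_born (D := D) hu
    exact ⟨_, List.mem_map_of_mem he, HRGrammar.mem_verts_map _ e ▸ List.mem_map_of_mem hue⟩
  · intro h
    obtain ⟨v, hv, hvu⟩ := List.mem_map.1 h
    exact disjoint_inputNodes_born hv (Encodable.encode_injective hvu ▸ hu)

/-- The places where non-terminals are rewritten: `none` for the start symbol, and one place for
each word. -/
abbrev Place (k : ℕ) : Type := Option (List (Fin k))

/-- The step in which a place is rewritten. -/
def level : Place k → ℕ
  | none => 0
  | some w => w.length + 1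

variable (D) in
/-- The non-terminal at a place. -/
def nonterminal : Place k → Fin (m + 1)
  | none => 0
  | some w => (D.eval w.reverse).succ

/-- The node that corresponds to a node of the right-hand side used at a place. -/
def nodeAt : Place k → Node k → Node k
  | none, u => u
  | some w, u => u.shift w

/-- The place where a node is created, and the node of the right-hand side it corresponds to. -/
def birth : Node k → Place k × Node k
  | main [] => (none, main [])
  | main (a :: w) => (some w, main [a])
  | test w => (some w, test [])
  | down b [] => (none, down b [])
  | down b (a :: w) => (some w, down b [a])
  | mark b a w => (some w, mark b a [])

theorem nodeAt_birth (u : Node k) : nodeAt (birth u).1 (birth u).2 = u := by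
  rcases u with (_ | _) | _ | ⟨_, _ | _⟩ | _ <;> rfl

theorem birth_mem_born (u : Node k) : (birth u).2 ∈ born (nonterminal D (birth u).1) := by
  rcases u with (_ | ⟨a, _⟩) | _ | ⟨_ | _, _ | ⟨a, _⟩⟩ | ⟨_ | _, a, _⟩ <;>
    simp [birth, born, nonterminal]

theorem birth_nodeAt {i : Place k} {u : Node k} (hu : u ∈ born (nonterminal D i)) :
    birth (nodeAt i u) = (i, u) := by
  cases i <;>
    simp only [born, nonterminal, Fin.cases_zero, Fin.cases_succ, List.mem_cons,
      List.mem_flatMap, List.mem_finRange, true_and] at hu <;>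
    grind [birth, nodeAt, shift]

theorem exists_mem_sources (u : Node k) :
    ∃ i, ∃ v ∈ sources (nonterminal D i), nodeAt i v = u := by
  rcases u with w | w | ⟨b, _ | ⟨a, w⟩⟩ | ⟨b, a, w⟩
  · exact ⟨some w, main [], by simp [sources, nonterminal], rfl⟩
  · exact ⟨some w, test [], by simp [sources, nonterminal], rfl⟩
  · exact ⟨none, down b [], by cases b <;> simp [sources, nonterminal], rfl⟩
  · exact ⟨some w, down b [a], by cases b <;> simp [sources, nonterminal], rfl⟩
  · exact ⟨some w, mark b a [], by cases b <;> simp [sources, nonterminal], rfl⟩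

theorem label_nodeAt {i : Place k} {u : Node k} (hu : u ∈ sources (nonterminal D i)) :
    (nodeAt i u).label = u.label := by
  cases i <;>
    simp only [sources, nonterminal, Fin.cases_zero, Fin.cases_succ, List.mem_cons,
      List.mem_flatMap, List.mem_finRange, true_and] at hu <;>
    grind [label, nodeAt, shift]

theorem succs_nodeAt {i : Place k} {u : Node k} (hu : u ∈ sources (nonterminal D i)) :
    (nodeAt i u).succs = u.succs.image (nodeAt i) := by
  cases i with
  | none => exact (Finset.image_id (s := u.succs)).symm
  | some w =>
    simp only [sources, nonterminal, Fin.cases_succ] at hu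
    rcases u with v | v | ⟨b, v⟩ | ⟨b, a, v⟩
    · obtain rfl : v = [] := by simpa using hu
      simp [nodeAt, shift, succs, Finset.image_insert, Finset.image_image, Function.comp_def]
    · obtain rfl : v = [] := by simpa using hu
      simp [nodeAt, shift, succs, Finset.image_insert]
    · obtain ⟨a, rfl⟩ : ∃ a, v = [a] := by simp at hu; grind
      simp [nodeAt, shift, succs, Finset.image_insert]
    · obtain rfl : v = [] := by grind
      rfl

theorem colours_nodeAt {i : Place k} {u : Node k} (hu : u ∈ born (nonterminal D i)) :
    colours D D.start (nodeAt i u) = colours D (Fin.cases D.start id (nonterminal D i)) u := by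
  cases i with
  | none => rfl
  | some w =>
    simp only [born, nonterminal, Fin.cases_succ] at hu
    rcases u with v | v | ⟨b, v⟩ | ⟨b, a, v⟩
    · obtain ⟨a, rfl⟩ : ∃ a, v = [a] := by simpa using hu
      have hstate : D.evalFrom D.start ([a] ++ w).reverse =
          D.evalFrom (D.eval w.reverse) [a].reverse := by
        simp [DFA.eval]
      simp only [nodeAt, shift, colours, nonterminal, Fin.cases_succ, id_eq]
      rw [hstate]
      rfl
    · rfl
    · obtain ⟨a, rfl⟩ : ∃ a, v = [a] := by simp at hu; grind
      rfl
    · rfl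

theorem exists_birth_main_eq (w : List (Fin k)) : ∃ i v, birth (main w) = (i, main v) := by
  cases w <;> exact ⟨_, _, rfl⟩

theorem level_of_birth_eq {w v : List (Fin k)} {i : Place k} (h : birth (main w) = (i, main v)) :
    level (some w) = level i + 1 := by
  cases w <;> obtain ⟨rfl, -⟩ := Prod.mk.inj h <;> rfl

theorem mem_calls {i : Place k} {q : Fin m} {v : List (Fin k)} :
    (q, v) ∈ calls D (nonterminal D i) ↔
      ∃ w, birth (main w) = (i, main v) ∧ D.eval w.reverse = q := by
  constructor
  · intro h
    rcases i with _ | w <;>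
      simp only [calls, nonterminal, Fin.cases_zero, Fin.cases_succ, List.mem_singleton,
        List.mem_map, List.mem_finRange, true_and, Prod.mk.injEq] at h
    · obtain ⟨rfl, rfl⟩ := h
      exact ⟨[], rfl, rfl⟩
    · obtain ⟨a, rfl, rfl⟩ := h
      exact ⟨a :: w, rfl, by simp⟩
  · rintro ⟨_ | ⟨a, w⟩, h, rfl⟩ <;> obtain ⟨rfl, hv⟩ := Prod.mk.inj h <;>
      obtain rfl := main.inj hv <;> simp [calls, nonterminal]

section Derivation

variable (R : (hrGrammar D).Derivation)

/-- The vertices of the non-terminal hyperarc that is created for a word. -/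
noncomputable def portVertices : List (Fin k) → List ℕ
  | [] => (ports []).map fun u : Node k => R.h 0 0 [] (Encodable.encode u)
  | a :: w => (ports [a]).map fun u => R.h (level (some w)) (nonterminal D (some w))
      (portVertices w) (Encodable.encode u)

/-- The vertices of the non-terminal hyperarc at a place. -/
noncomputable def placeVertices : Place k → List ℕ
  | none => []
  | some w => portVertices R w

/-- The copy of a node of a right-hand side that is made at a place. -/
noncomputable def copy (i : Place k) (u : Node k) : ℕ :=
  R.h (level i) (nonterminal D i) (placeVertices R i) (Encodable.encode u)

/-- The vertex of the generated graph that represents a node. -/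
noncomputable def vertex (u : Node k) : ℕ := copy R (birth u).1 (birth u).2

theorem placeVertices_some (w : List (Fin k)) :
    placeVertices R (some w) = (ports w).map (vertex R) := by
  cases w <;> rfl

theorem placeVertices_of_birth_eq {w v : List (Fin k)} {i : Place k}
    (h : birth (main w) = (i, main v)) : placeVertices R (some w) = (ports v).map (copy R i) := by
  cases w <;> obtain ⟨rfl, hv⟩ := Prod.mk.inj h <;> obtain rfl := main.inj hv <;> rfl

theorem nonterm_mem_H {n : ℕ} {A : Fin (m + 1)} {u : List ℕ} : .nonterm A u ∈ R.H n ↔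
    ∃ i, level i = n ∧ nonterminal D i = A ∧ placeVertices R i = u := by
  induction n generalizing A u with
  | zero =>
    rw [R.nonterm_mem_zero]
    constructor
    · rintro ⟨rfl, rfl⟩
      exact ⟨none, rfl, rfl, rfl⟩
    · rintro ⟨_ | w, h, rfl, rfl⟩
      · exact ⟨rfl, rfl⟩
      · exact absurd h (Nat.succ_ne_zero _)
  | succ n ih =>
    simp only [R.nonterm_mem_succ, ih]
    constructor
    · rintro ⟨_, _, ⟨i, rfl, rfl, rfl⟩, v, hv, rfl⟩
      obtain ⟨_ | _ | _, he, h⟩ := List.mem_map.1 hv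
      · obtain ⟨rfl, rfl⟩ := Hyperarc.nonterm.inj h
        obtain ⟨⟨q, v⟩, hp, rfl, rfl⟩ := nonterm_mem_rule.1 he
        obtain ⟨w, hw, rfl⟩ := mem_calls.1 hp
        exact ⟨some w, level_of_birth_eq hw, rfl,
          (placeVertices_of_birth_eq R hw).trans (List.map_map ..).symm⟩
      all_goals exact nomatch h
    · rintro ⟨_ | w, hi, rfl, rfl⟩
      · exact absurd hi.symm (Nat.succ_ne_zero n)
      · obtain ⟨i, v, hw⟩ := exists_birth_main_eq w
        obtain rfl := Nat.succ.inj ((level_of_birth_eq hw).symm.trans hi)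
        refine ⟨_, _, ⟨i, rfl, rfl, rfl⟩, _,
          List.mem_map_of_mem (nonterm_mem_rule.2 ⟨_, mem_calls.2 ⟨w, hw, rfl⟩, rfl, rfl⟩), ?_⟩
        exact (List.map_map ..).trans (placeVertices_of_birth_eq R hw).symm

theorem nonterm_mem (i : Place k) :
    .nonterm (nonterminal D i) (placeVertices R i) ∈ R.H (level i) :=
  (nonterm_mem_H R).2 ⟨i, rfl, rfl, rfl⟩

theorem level_eq_of_copy_eq {i j : Place k} {u v : Node k} (hu : u ∈ born (nonterminal D i))
    (hv : v ∈ born (nonterminal D j)) (h : copy R i u = copy R j v) :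
    level i = level j ∧ placeVertices R i = placeVertices R j ∧ u = v := by
  obtain ⟨hl, -, hp, hc⟩ := R.apply_inj (nonterm_mem R i) (nonterm_mem R j)
    (encode_mem_newVertices hu) (encode_mem_newVertices hv) h
  exact ⟨hl, hp, Encodable.encode_injective hc⟩

theorem vertex_main_eq_of_placeVertices_eq {w v : List (Fin k)}
    (h : placeVertices R (some w) = placeVertices R (some v)) :
    vertex R (main w) = vertex R (main v) := by
  rw [placeVertices_some, placeVertices_some] at h
  exact (List.cons.inj h).1

theorem vertex_main_injective : Function.Injective fun w : List (Fin k) => vertex R (main w) := by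
  intro w v h
  induction w generalizing v with
  | nil =>
    obtain ⟨hl, -⟩ := level_eq_of_copy_eq R (birth_mem_born (main [])) (birth_mem_born (main v)) h
    cases v with
    | nil => rfl
    | cons b v => exact absurd hl.symm (Nat.succ_ne_zero _)
  | cons a w ih =>
    obtain ⟨hl, hp, hc⟩ :=
      level_eq_of_copy_eq R (birth_mem_born (main (a :: w))) (birth_mem_born (main v)) h
    cases v with
    | nil => exact absurd hl (Nat.succ_ne_zero _)
    | cons b v =>
      obtain rfl : a = b := by simpa [birth] using hc
      rw [ih (vertex_main_eq_of_placeVertices_eq R hp)]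

theorem vertex_injective : Function.Injective (vertex R) := by
  intro u v h
  obtain ⟨hl, hp, hc⟩ := level_eq_of_copy_eq R (birth_mem_born u) (birth_mem_born v) h
  suffices (birth u).1 = (birth v).1 by
    rw [← nodeAt_birth u, ← nodeAt_birth v, this, hc]
  revert hl hp
  rcases (birth u).1 with _ | w <;> rcases (birth v).1 with _ | w' <;> intro hl hp
  · rfl
  · exact absurd hl.symm (Nat.succ_ne_zero _)
  · exact absurd hl (Nat.succ_ne_zero _)
  · rw [vertex_main_injective R (vertex_main_eq_of_placeVertices_eq R hp)]

theorem copy_eq_vertex {i : Place k} {u : Node k}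
    (hu : u ∈ inputNodes (nonterminal D i) ∨ u ∈ born (nonterminal D i)) :
    copy R i u = vertex R (nodeAt i u) := by
  obtain hu | hu := hu
  · cases i with
    | none => simp [inputNodes, nonterminal] at hu
    | some w =>
      have hinputs : (ports []).map (copy R (some w)) =
          (ports []).map (vertex R ∘ nodeAt (some w)) := by
        refine Eq.trans ?_ (placeVertices_some R w)
        rw [← (R.step _).map_inputs _ _ (nonterm_mem R (some w))]
        exact (List.map_map ..).symm
      exact List.map_inj_left.1 hinputs u hu
  · rw [vertex, birth_nodeAt hu]

theorem mem_graph {r} : r ∈ R.graph ↔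
    ∃ i, ∃ e ∈ rule D (nonterminal D i), e.IsTerminal ∧ r = e.map (copy R i) := by
  rw [R.mem_graph]
  constructor
  · rintro ⟨n, A, u, hA, e', he', ht, rfl⟩
    obtain ⟨i, rfl, rfl, rfl⟩ := (nonterm_mem_H R).1 hA
    obtain ⟨e, he, rfl⟩ := List.mem_map.1 he'
    exact ⟨i, e, he, Hyperarc.isTerminal_map.1 ht, Hyperarc.map_map _ _ e⟩
  · rintro ⟨i, e, he, ht, rfl⟩
    exact ⟨_, _, _, nonterm_mem R i, _, List.mem_map_of_mem he, Hyperarc.isTerminal_map.2 ht,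
      (Hyperarc.map_map _ _ e).symm⟩

theorem arc_mem_graph {l : Fin 3} {x y : ℕ} : .arc l x y ∈ R.graph ↔
    ∃ u : Node k, ∃ v ∈ u.succs, l = u.label ∧ x = vertex R u ∧ y = vertex R v := by
  rw [mem_graph]
  constructor
  · rintro ⟨i, _ | ⟨_, u, v⟩ | _, he, -, h⟩
    case arc =>
      obtain ⟨rfl, rfl, rfl⟩ := Hyperarc.arc.inj h
      obtain ⟨hu, hv, rfl⟩ := arc_mem_rule.1 he
      rw [copy_eq_vertex R (mem_inputNodes_or_mem_born_of_mem_sources hu),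
        copy_eq_vertex R (mem_inputNodes_or_mem_born_of_mem_succs hu hv)]
      refine ⟨nodeAt i u, nodeAt i v, ?_, (label_nodeAt hu).symm, rfl, rfl⟩
      exact succs_nodeAt hu ▸ Finset.mem_image_of_mem _ hv
    all_goals exact nomatch h
  · rintro ⟨u, v, hv, rfl, rfl, rfl⟩
    obtain ⟨i, u, hu, rfl⟩ := exists_mem_sources (D := D) u
    rw [succs_nodeAt hu] at hv
    obtain ⟨t, ht, rfl⟩ := Finset.mem_image.1 hv
    refine ⟨i, .arc u.label u t, arc_mem_rule.2 ⟨hu, ht, rfl⟩, trivial, ?_⟩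
    rw [label_nodeAt hu, ← copy_eq_vertex R (mem_inputNodes_or_mem_born_of_mem_sources hu),
      ← copy_eq_vertex R (mem_inputNodes_or_mem_born_of_mem_succs hu ht)]
    rfl

theorem colour_mem_graph {c : Fin (Fintype.card (Colour k))} {x : ℕ} : .colour c x ∈ R.graph ↔
    ∃ u : Node k, x = vertex R u ∧ ∃ d ∈ colours D D.start u, d.idx = c := by
  rw [mem_graph]
  constructor
  · rintro ⟨i, _ | _ | ⟨_, u⟩, he, -, h⟩
    case colour =>
      obtain ⟨rfl, rfl⟩ := Hyperarc.colour.inj h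
      obtain ⟨hu, hc⟩ := colour_mem_rule.1 he
      exact ⟨nodeAt i u, copy_eq_vertex R (.inr hu), colours_nodeAt hu ▸ hc⟩
    all_goals exact nomatch h
  · rintro ⟨u, rfl, hc⟩
    have hu := birth_mem_born (D := D) u
    rw [← nodeAt_birth u, colours_nodeAt hu] at hc
    exact ⟨_, .colour c _, colour_mem_rule.2 ⟨hu, hc⟩, trivial, rfl⟩

theorem vertexSet_graph : vertexSet R.graph = Set.range (vertex R) := by
  ext x
  constructor
  · rintro ⟨_ | ⟨l, y, z⟩ | ⟨c, y⟩, he, hx⟩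
    · obtain ⟨i, _ | _ | _, -, ht, h⟩ := (mem_graph R).1 he
      · exact ht.elim
      all_goals exact nomatch h
    · obtain ⟨u, v, -, -, rfl, rfl⟩ := (arc_mem_graph R).1 he
      obtain rfl | rfl : x = vertex R u ∨ x = vertex R v := by simpa [Hyperarc.verts] using hx
      · exact ⟨u, rfl⟩
      · exact ⟨v, rfl⟩
    · obtain ⟨u, rfl, -⟩ := (colour_mem_graph R).1 he
      obtain rfl : x = vertex R u := List.mem_singleton.1 hx
      exact ⟨u, rfl⟩
  · rintro ⟨u, rfl⟩
    obtain ⟨v, hv⟩ := succs_nonempty u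
    exact ⟨_, (arc_mem_graph R).2 ⟨u, v, hv, rfl, rfl, rfl⟩, List.mem_cons_self⟩

end Derivation

variable (D)

theorem targets_graph (R : (hrGrammar D).Derivation) (u : Node k) (l : Fin 3) :
    targets R.graph (vertex R u) l = if l = u.label then vertex R '' u.succs else ∅ := by
  ext y
  rw [targets, Set.mem_ofPred_eq, arc_mem_graph]
  constructor
  · rintro ⟨u', v, hv, rfl, hu, rfl⟩
    obtain rfl := vertex_injective R hu
    exact if_pos (rfl : u.label = u.label) ▸ ⟨v, hv, rfl⟩
  · split_ifs with hl
    · rintro ⟨v, hv, rfl⟩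
      exact ⟨u, v, hv, hl, rfl, rfl⟩
    · exact False.elim

/-- The probabilistic hypergraph grammar of an automaton. -/
noncomputable def grammar : PHRGrammar where
  toHRGrammar := hrGrammar D
  μ l := ⟨weight k l, weight_nonneg l, weight_le_one l⟩
  finite_targets x hx l := by
    obtain ⟨u, rfl⟩ := (vertexSet_graph (hrGrammar D).derivation ▸ hx :)
    change (targets (hrGrammar D).derivation.graph _ l).Finite
    rw [targets_graph]
    split_ifs
    exacts [u.succs.finite_toSet.image _, Set.finite_empty]
  sum_eq_one x hx := by
    obtain ⟨u, rfl⟩ := (vertexSet_graph (hrGrammar D).derivation ▸ hx :)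
    change ∑ l, weight k l * ((targets (hrGrammar D).derivation.graph _ l).ncard : ℚ) = 1
    have hcard (l : Fin 3) : (targets (hrGrammar D).derivation.graph
        (vertex (hrGrammar D).derivation u) l).ncard = if l = u.label then u.succs.card else 0 := by
      rw [targets_graph, apply_ite Set.ncard, Set.ncard_image_of_injective _ (vertex_injective _),
        Set.ncard_coe_finset, Set.ncard_empty]
    simp only [hcard, Nat.cast_ite, Nat.cast_zero, mul_ite, mul_zero, Finset.sum_ite_eq',
      Finset.mem_univ, if_true, weight_mul_card_succs]

/-- The states of the Markov chain are the nodes. -/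
noncomputable def point : Node k ≃ (grammar D).Vertex :=
  (Equiv.ofInjective _ (vertex_injective (hrGrammar D).derivation)).trans
    (Equiv.setCongr (vertexSet_graph (hrGrammar D).derivation).symm)

theorem step_point (u v : Node k) : (grammar D).chain.step (point D u) (point D v) =
    if v ∈ u.succs then ENNReal.ofReal (weight k u.label : ℚ) else 0 := by
  classical
  have hmem (l : Fin 3) : vertex (hrGrammar D).derivation v ∈
      targets (hrGrammar D).derivation.graph (vertex (hrGrammar D).derivation u) l ↔
        l = u.label ∧ v ∈ u.succs := by
    rw [targets_graph]
    split_ifs with hl <;> simp [hl, (vertex_injective _).eq_iff]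
  change (grammar D).transProb (vertex _ u) (vertex _ v) = _
  rw [PHRGrammar.transProb]
  refine (Finset.sum_eq_single (ι := Fin 3) u.label ?_ ?_).trans ?_
  · exact fun l _ hl => if_neg fun h => hl ((hmem l).1 h).1
  · exact fun h => absurd (Finset.mem_univ _) h
  · exact if_congr ((hmem u.label).trans (and_iff_right rfl)) rfl rfl

theorem weight_label_pos (u : Node k) : 0 < weight k u.label :=
  (weight_nonneg _).lt_of_ne fun h => by simpa [← h] using u.weight_mul_card_succs

theorem step_point_ne_zero {u v : Node k} :
    (grammar D).chain.step (point D u) (point D v) ≠ 0 ↔ v ∈ u.succs := by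
  simp [step_point, weight_label_pos]

theorem tsum_step_point (u : Node k) (f : (grammar D).Vertex → ℝ≥0∞) :
    ∑' t, (grammar D).chain.step (point D u) t * f t =
      ∑ v ∈ u.succs, ENNReal.ofReal (weight k u.label : ℚ) * f (point D v) := by
  rw [← (point D).tsum_eq, tsum_eq_sum fun v hv => by rw [step_point, if_neg hv, zero_mul]]
  exact Finset.sum_congr rfl fun v hv => by rw [step_point, if_pos hv]

theorem mem_label_point {c : Colour k} {u : Node k} :
    c.idx ∈ (grammar D).chain.label (point D u) ↔ c ∈ colours D D.start u := by
  refine (colour_mem_graph (hrGrammar D).derivation).trans ⟨?_, fun h => ⟨u, rfl, c, h, rfl⟩⟩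
  rintro ⟨v, hv, d, hd, hdc⟩
  obtain rfl := vertex_injective _ hv
  exact Colour.idx_injective hdc ▸ hd

end Automaton

theorem sum_map_eq_countP_sub_countP {ι : Type*} {d : ι → ℤ} (hd : ∀ a, |d a| ≤ 1)
    (w : List ι) : (w.map d).sum = w.countP (d · = 1) - w.countP (d · = -1) := by
  induction w with
  | nil => rfl
  | cons a w ih =>
    obtain ⟨h₁, h₂⟩ := abs_le.1 (hd a)
    rw [List.map_cons, List.sum_cons, ih, List.countP_cons, List.countP_cons]
    interval_cases d a <;> norm_num <;> ring

namespace Automaton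

open Node

variable {k m : ℕ}

/-! ## Comparison of numbers of letters -/

/-- Formulae over the colours. -/
abbrev Formula (k : ℕ) : Type := PCTL (Fin (Fintype.card (Colour k)))

/-- The formula that holds where the colour `c` is present. -/
noncomputable def colourF (c : Colour k) : Formula k := .atom c.idx

/-- The formula that holds where no colour in `C` is present. -/
noncomputable def noneF (C : Finset (Colour k)) : Formula k :=
  .listConj (C.toList.map fun c => .neg (colourF c))

/-- A formula for the states that a comparison of the numbers of letters in `I` and in `J`
traverses. -/
noncomputable def stayF (I : Finset (Fin k)) : Formula k :=
  noneF (insert (.halt false) (I.image (.mark true)))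

/-- A formula for the states that a comparison of the numbers of letters in `I` and in `J` tries to
reach. -/
noncomputable def goalF (J : Finset (Fin k)) : Formula k :=
  .neg (noneF (insert (.halt true) (J.image (.mark false))))

variable (D : DFA (Fin k) (Fin m))

/-- The formula `φ` holds at the node `u`. -/
def Sat (φ : Formula k) (u : Node k) : Prop := point D u ∈ (grammar D).chain.sat φ

/-- The probability of the paths of `φ U ψ` from a node. -/
noncomputable def untlProb (φ ψ : Formula k) (u : Node k) : ℝ :=
  ((grammar D).chain.pathMeasure (point D u)).real
    (untilPaths ((grammar D).chain.sat φ) ((grammar D).chain.sat ψ))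

variable {D} {φ ψ : Formula k} {u : Node k} {I J : Finset (Fin k)}

theorem sat_colourF {c : Colour k} : Sat D (colourF c) u ↔ c ∈ colours D D.start u :=
  mem_label_point D

theorem sat_neg : Sat D (.neg φ) u ↔ ¬ Sat D φ u := Iff.rfl

theorem sat_conj : Sat D (.conj φ ψ) u ↔ Sat D φ u ∧ Sat D ψ u := Iff.rfl

theorem sat_listConj {l : List (Formula k)} : Sat D (.listConj l) u ↔ ∀ φ ∈ l, Sat D φ u :=
  LabelledMarkovChain.mem_sat_listConj _

theorem sat_next_gt_zero : Sat D (.next .gt 0 φ) u ↔ ∃ v ∈ u.succs, Sat D φ v :=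
  (LabelledMarkovChain.mem_sat_next_gt_zero _).trans <| (point D).surjective.exists.trans <|
    exists_congr fun _ => and_congr_left fun _ => step_point_ne_zero D

theorem sat_noneF {C : Finset (Colour k)} :
    Sat D (noneF C) u ↔ ∀ c ∈ C, c ∉ colours D D.start u := by
  simp [noneF, sat_listConj, sat_neg, sat_colourF]

theorem sat_stayF : Sat D (stayF I) u ↔ .halt false ∉ colours D D.start u ∧
    ∀ a ∈ I, .mark true a ∉ colours D D.start u := by
  simp [stayF, sat_noneF]

theorem sat_goalF : Sat D (goalF J) u ↔ .halt true ∈ colours D D.start u ∨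
    ∃ a ∈ J, .mark false a ∈ colours D D.start u := by
  simp only [goalF, sat_neg, sat_noneF, Finset.forall_mem_insert, Finset.forall_mem_image,
    not_and_or, not_not, not_forall, exists_prop]

theorem untlProb_of_sat (h : Sat D ψ u) : untlProb D φ ψ u = 1 := by
  rw [untlProb, measureReal_def, LabelledMarkovChain.pathMeasure_untilPaths_of_mem _ h,
    ENNReal.toReal_one]

theorem untlProb_of_not_sat (hφ : ¬ Sat D φ u) (hψ : ¬ Sat D ψ u) : untlProb D φ ψ u = 0 := by
  rw [untlProb, measureReal_def, LabelledMarkovChain.pathMeasure_untilPaths_of_notMem _ hφ hψ,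
    ENNReal.toReal_zero]

theorem untlProb_step (hφ : Sat D φ u) (hψ : ¬ Sat D ψ u) :
    untlProb D φ ψ u = (weight k u.label : ℚ) * ∑ v ∈ u.succs, untlProb D φ ψ v := by
  rw [untlProb, measureReal_def, LabelledMarkovChain.pathMeasure_untilPaths_step _ hφ hψ,
    tsum_step_point, ← Finset.mul_sum, ENNReal.toReal_mul,
    ENNReal.toReal_ofReal (Rat.cast_nonneg.2 (weight_nonneg _)),
    ENNReal.toReal_sum fun _ _ => measure_ne_top _ _]
  rfl

/-- Each letter in `I` halves the distance from the probability to `c`. -/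
theorem untlProb_down {b : Bool} {c : ℝ}
    (hdown : ∀ a w, Sat D φ (down b (a :: w)) ∧ ¬ Sat D ψ (down b (a :: w)))
    (hmem : ∀ a ∈ I, ∀ w, untlProb D φ ψ (mark b a w) = c)
    (hnotMem : ∀ a ∉ I, ∀ w, Sat D φ (mark b a w) ∧ ¬ Sat D ψ (mark b a w)) (w : List (Fin k)) :
    untlProb D φ ψ (down b w) =
      c + (untlProb D φ ψ (down b []) - c) * (1 / 2) ^ w.countP (· ∈ I) := by
  induction w with
  | nil => simp
  | cons a w ih =>
    have hstep : untlProb D φ ψ (down b (a :: w)) =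
        1 / 2 * (untlProb D φ ψ (down b w) + untlProb D φ ψ (mark b a w)) := by
      rw [untlProb_step (hdown a w).1 (hdown a w).2]
      simp [label, succs, weight]
    by_cases ha : a ∈ I
    · rw [hstep, hmem a ha, ih, List.countP_cons_of_pos (by simpa using ha), pow_succ]
      ring
    · have hmark : untlProb D φ ψ (mark b a w) = untlProb D φ ψ (down b w) := by
        rw [untlProb_step (hnotMem a ha w).1 (hnotMem a ha w).2]
        simp [label, succs, weight]
      rw [hstep, hmark, ih, List.countP_cons_of_neg (by simpa using ha)]
      ring

theorem untlProb_down_true (w : List (Fin k)) :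
    untlProb D (stayF I) (goalF J) (down true w) = (1 / 2) ^ w.countP (· ∈ I) := by
  have hnil : untlProb D (stayF I) (goalF J) (down true []) = 1 :=
    untlProb_of_sat (by simp [sat_goalF, colours])
  rw [untlProb_down (I := I) (c := 0), hnil]
  · ring
  · simp [sat_stayF, sat_goalF, colours]
  · exact fun a ha w => untlProb_of_not_sat (by simp [sat_stayF, colours, ha])
      (by simp [sat_goalF, colours])
  · simp +contextual [sat_stayF, sat_goalF, colours]

theorem untlProb_down_false (w : List (Fin k)) :
    untlProb D (stayF I) (goalF J) (down false w) = 1 - (1 / 2) ^ w.countP (· ∈ J) := by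
  have hnil : untlProb D (stayF I) (goalF J) (down false []) = 0 :=
    untlProb_of_not_sat (by simp [sat_stayF, colours]) (by simp [sat_goalF, colours])
  rw [untlProb_down (I := J) (c := 1), hnil]
  · ring
  · simp [sat_stayF, sat_goalF, colours]
  · exact fun a ha w => untlProb_of_sat (by simp [sat_goalF, colours, ha])
  · simp +contextual [sat_stayF, sat_goalF, colours]

theorem untlProb_test (w : List (Fin k)) : untlProb D (stayF I) (goalF J) (test w) =
    1 / 2 * ((1 / 2) ^ w.countP (· ∈ I) + (1 - (1 / 2) ^ w.countP (· ∈ J))) := by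
  rw [untlProb_step (by simp [sat_stayF, colours]) (by simp [sat_goalF, colours]),
    ← untlProb_down_true (D := D) (J := J), ← untlProb_down_false (D := D) (I := I)]
  simp [label, succs, weight]

/-- The threshold `1 / 2`. -/
def half : RatProb := ⟨1 / 2, by norm_num, by norm_num⟩

/-- The formula that holds at `main w` if the sum of the values of `d` at the letters of `w` is
`n`, provided that `d` has values in `{-1, 0, 1}`, and has values in `{0, 1}` or `n = 0`. -/
noncomputable def sumF (d : Fin k → ℤ) (n : ℕ) : Formula k :=
  .next .gt 0 (.conj (colourF .test) (.untlEq (half ^ (n + 1)) (stayF {a | d a = 1})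
    (goalF {a | d a = -1})))

theorem sat_sumF {d : Fin k → ℤ} {n : ℕ} {w : List (Fin k)} : Sat D (sumF d n) (main w) ↔
    (1 / 2 : ℝ) * ((1 / 2) ^ w.countP (d · = 1) + (1 - (1 / 2) ^ w.countP (d · = -1))) =
      (1 / 2) ^ (n + 1) := by
  have huntl (u : Node k) : Sat D (.untlEq (half ^ (n + 1)) (stayF {a | d a = 1})
      (goalF {a | d a = -1})) u ↔
        untlProb D (stayF {a | d a = 1}) (goalF {a | d a = -1}) u = (1 / 2) ^ (n + 1) := by
    refine (LabelledMarkovChain.mem_sat_untlEq _).trans ?_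
    simp [half, untlProb]
  simp only [sumF, sat_next_gt_zero, sat_conj, sat_colourF, huntl]
  simp [succs, colours, untlProb_test]

theorem sat_sumF_zero {d : Fin k → ℤ} (hd : ∀ a, |d a| ≤ 1) {w : List (Fin k)} :
    Sat D (sumF d 0) (main w) ↔ (w.map d).sum = 0 := by
  rw [sat_sumF, sum_map_eq_countP_sub_countP hd, sub_eq_zero, Nat.cast_inj,
    ← pow_right_inj₀ (a := (1 / 2 : ℝ)) (by norm_num) (by norm_num)]
  constructor <;> intro h <;> linarith

theorem sat_sumF_of_nonneg {d : Fin k → ℤ} (hd₀ : ∀ a, 0 ≤ d a) (hd₁ : ∀ a, d a ≤ 1) {n : ℕ}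
    {w : List (Fin k)} : Sat D (sumF d n) (main w) ↔ (w.map d).sum = n := by
  have hneg : w.countP (d · = -1) = 0 := by
    rw [List.countP_eq_zero]
    intro a _
    have := hd₀ a
    simp only [decide_eq_true_eq]
    omega
  rw [sat_sumF, sum_map_eq_countP_sub_countP fun a => abs_le.2 ⟨by linarith [hd₀ a], hd₁ a⟩, hneg,
    Nat.cast_zero, sub_zero, Nat.cast_inj,
    ← pow_right_inj₀ (a := (1 / 2 : ℝ)) (by norm_num) (by norm_num), pow_succ]
  constructor <;> intro h <;> linarith

/-! ## Simulation of counter programs -/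

variable {op : Fin k → Op} {a : Fin k} {w : List (Fin k)} {n : ℕ}

/-- The counters after the instructions of a word. -/
def counters (op : Fin k → Op) (w : List (Fin k)) : Counters := (w.map fun a => (op a).delta).sum

/-- The instructions of a word pass all their tests. -/
def Passes (op : Fin k → Op) (w : List (Fin k)) : Prop :=
  Op.Exec (w.reverse.map op) 0 (counters op w)

/-- The instructions of some word that the automaton accepts pass all their tests, and leave `n` in
the counter `0`. -/
def Accepts (D : DFA (Fin k) (Fin m)) (op : Fin k → Op) (n : ℕ) : Prop :=
  ∃ w, Passes op w ∧ D.eval w.reverse ∈ D.accept ∧ counters op w 0 = n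

theorem exec_iff_passes {s : Counters} :
    Op.Exec (w.reverse.map op) 0 s ↔ Passes op w ∧ s = counters op w := by
  refine ⟨fun h => ?_, fun ⟨h, hs⟩ => hs ▸ h⟩
  obtain rfl : s = counters op w := by
    rw [h.eq_add_sum, zero_add, List.map_map, List.map_reverse, List.sum_reverse]
    rfl
  exact ⟨h, rfl⟩

/-- The test of an instruction can also be made after its execution, which does not change the
tested value. -/
theorem passes_cons :
    Passes op (a :: w) ↔ Passes op w ∧ (op a).test (counters op (a :: w)) = 0 := by
  have hcounters : counters op (a :: w) = counters op w + (op a).delta := add_comm _ _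
  have htest : (op a).test (counters op (a :: w)) = (op a).test (counters op w) := by
    rw [hcounters, map_add, Op.test_delta_self, add_zero]
  rw [htest, Passes, List.reverse_cons, List.map_append, Op.exec_append]
  simp only [exec_iff_passes]
  constructor
  · rintro ⟨_, ⟨h, rfl⟩, ht, -⟩
    exact ⟨h, ht⟩
  · rintro ⟨h, ht⟩
    exact ⟨_, ⟨h, rfl⟩, ht, hcounters⟩

theorem map_counters {A : Type*} [AddMonoid A] (f : Counters →+ A) :
    f (counters op w) = (w.map fun a => f (op a).delta).sum := by
  rw [counters, map_list_sum, List.map_map]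
  rfl

theorem test_notMem_colours_main : .test ∉ colours D D.start (main w) := by
  cases w <;> simp only [colours] <;> split_ifs <;> simp

theorem letter_mem_colours_main : .letter a ∈ colours D D.start (main w) ↔ a ∈ w.head? := by
  cases w <;> simp only [colours] <;> split_ifs <;> simp [eq_comm]

theorem acc_mem_colours_main :
    .acc ∈ colours D D.start (main w) ↔ D.eval w.reverse ∈ D.accept := by
  cases w <;> simp only [colours] <;> split_ifs <;> simp_all [DFA.eval]

theorem root_mem_colours {u : Node k} : .root ∈ colours D D.start u ↔ u = main [] := by
  rcases u with (_ | _) | _ | ⟨_, _ | _⟩ | _ <;> simp only [colours] <;> try split_ifs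
  all_goals simp

/-- The formula that holds at a main node if the last instruction has passed its test. -/
noncomputable def okF (op : Fin k → Op) : Formula k :=
  .conj (.neg (colourF .test)) (.listConj ((List.finRange k).map fun a =>
    .neg (.conj (colourF (.letter a)) (.neg (sumF (fun c => (op a).test (op c).delta) 0)))))

/-- The formula that holds at a main node if the automaton accepts its word, the last
instruction has passed its test, and the counter `0` contains `n`. -/
noncomputable def acceptF (op : Fin k → Op) (n : ℕ) : Formula k :=
  .conj (okF op) (.conj (colourF .acc) (sumF (fun c => (op c).delta 0) n))

/-- The formula that holds at the root if the input `n` is accepted, and nowhere else. -/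
noncomputable def haltF (op : Fin k → Op) (n : ℕ) : Formula k :=
  .conj (colourF .root) (.untl .gt 0 (okF op) (acceptF op n))

theorem not_sat_okF_test : ¬ Sat D (okF op) (test w) :=
  fun h => h.1 (sat_colourF.2 (List.mem_singleton_self _))

theorem sat_okF : Sat D (okF op) (main w) ↔
    ∀ a ∈ w.head?, (op a).test (counters op w) = 0 := by
  have htest (a : Fin k) : Sat D (sumF (fun c => (op a).test (op c).delta) 0) (main w) ↔
      (op a).test (counters op w) = 0 := by
    rw [sat_sumF_zero fun c => Op.abs_test_delta_le _ _, map_counters]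
  simp [okF, sat_conj, sat_neg, sat_listConj, sat_colourF, htest, test_notMem_colours_main,
    letter_mem_colours_main]

theorem passes_iff : Passes op w ↔ Passes op w.tail ∧ Sat D (okF op) (main w) := by
  cases w with
  | nil => simp [sat_okF]
  | cons a w => simp [sat_okF, passes_cons]

theorem sat_acceptF : Sat D (acceptF op n) (main w) ↔
    Sat D (okF op) (main w) ∧ D.eval w.reverse ∈ D.accept ∧ counters op w 0 = n := by
  have hcount : counters op w 0 = (w.map fun a => (op a).delta 0).sum :=
    map_counters (Pi.evalAddMonoidHom (fun _ => ℤ) 0)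
  rw [acceptF, sat_conj, sat_conj, sat_colourF, acc_mem_colours_main, hcount,
    sat_sumF_of_nonneg (fun _ => Op.delta_zero_nonneg _) fun _ =>
      (abs_le.1 (Op.abs_delta_le _ 0)).2]

variable (D) in
/-- The chain can go from the node `u` through `okF op` to `acceptF op n`. -/
abbrev CanAccept (op : Fin k → Op) (n : ℕ) (u : Node k) : Prop :=
  (grammar D).chain.CanReach ((grammar D).chain.sat (okF op)) ((grammar D).chain.sat (acceptF op n))
    (point D u)

theorem CanAccept.sat_okF {u : Node k} (h : CanAccept D op n u) : Sat D (okF op) u := by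
  rcases h with h | ⟨h, -, -⟩
  exacts [h.1, h]

theorem CanAccept.accepts (h : CanAccept D op n (main w)) (hw : Passes op w.tail) :
    Accepts D op n := by
  obtain ⟨s, hs⟩ : ∃ s, s = point D (main w) := ⟨_, rfl⟩
  rw [CanAccept, ← hs] at h
  induction h generalizing w with
  | base h =>
    subst hs
    obtain ⟨hok, hacc, hn⟩ := sat_acceptF.1 h
    exact ⟨w, passes_iff.2 ⟨hw, hok⟩, hacc, hn⟩
  | @step s t hok hst ht ih =>
    subst hs
    obtain ⟨v, rfl⟩ := (point D).surjective t
    have hv := (step_point_ne_zero D).1 hst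
    simp only [succs, Finset.mem_insert, Finset.mem_image, Finset.mem_univ, true_and] at hv
    obtain rfl | ⟨a, rfl⟩ := hv
    · exact absurd (CanAccept.sat_okF ht) not_sat_okF_test
    · exact ih (w := a :: w) (passes_iff.2 ⟨hw, hok⟩) rfl

theorem CanAccept.main_nil (h : CanAccept D op n (main w)) (hw : Passes op w) :
    CanAccept D op n (main []) := by
  induction w with
  | nil => exact h
  | cons a w ih =>
    have hw' : Passes op w := (passes_cons.1 hw).1
    exact ih (.step (passes_iff.1 hw').2 ((step_point_ne_zero D).2 (by simp [succs])) h) hw'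

theorem canAccept_main_nil : CanAccept D op n (main []) ↔ Accepts D op n := by
  refine ⟨fun h => h.accepts rfl, fun ⟨w, hw, hacc, hn⟩ => ?_⟩
  exact CanAccept.main_nil (.base (sat_acceptF.2 ⟨(passes_iff.1 hw).2, hacc, hn⟩)) hw

theorem sat_haltF {u : Node k} : Sat D (haltF op n) u ↔ u = main [] ∧ Accepts D op n := by
  rw [haltF, sat_conj, sat_colourF, root_mem_colours]
  refine and_congr_right ?_
  rintro rfl
  exact (LabelledMarkovChain.mem_sat_untl_gt_zero _).trans canAccept_main_nil

end Automaton

/-! ## Undecidability -/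

namespace DecidableProblem

variable {I J α β : Type} [Primcodable α] [Primcodable β] {code : I → α} {Q : I → Prop}

theorem comp (h : DecidableProblem code Q) {code' : J → β} (f : J → I) {g : β → α}
    (hg : Computable g) (hcode : ∀ y, code (f y) = g (code' y)) :
    DecidableProblem code' fun y => Q (f y) := by
  obtain ⟨a, ha, hQ⟩ := h
  exact ⟨fun b => a (g b), ha.comp hg, fun y => by simpa only [hcode] using hQ (f y)⟩

theorem not (h : DecidableProblem code Q) : DecidableProblem code fun x => ¬ Q x := by
  obtain ⟨a, ha, hQ⟩ := h
  refine ⟨fun b => (a b).map Bool.not, ha.map (Primrec.not.to_comp.comp .snd), fun x => ?_⟩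
  obtain ⟨b, hb, hbQ⟩ := hQ x
  exact ⟨!b, Part.mem_map _ hb, by simp [← hbQ]⟩

theorem computablePred [Primcodable I] {Q : I → Prop}
    (h : DecidableProblem (Encodable.encode : I → ℕ) Q) : ComputablePred Q := by
  classical
  obtain ⟨a, ha, hQ⟩ := h
  refine ⟨inferInstance, (ha.comp Computable.encode).of_eq fun x => ?_⟩
  obtain ⟨b, hb, hbQ⟩ := hQ x
  obtain rfl : b = decide (Q x) := by rw [Bool.eq_iff_iff, hbQ, decide_eq_true_iff]
  exact Part.eq_some_iff.2 hb

end DecidableProblem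

namespace PCTL

variable {k : ℕ} {φ ψ : ℕ → PCTL (Fin k)} {ρ : ℕ → RatProb}

theorem primrec_code_conj (hφ : Primrec fun n => (φ n).code) (hψ : Primrec fun n => (ψ n).code) :
    Primrec fun n => (PCTL.conj (φ n) (ψ n)).code :=
  Primrec₂.natPair.comp (.const 3) (Primrec₂.natPair.comp hφ hψ)

theorem primrec_code_next (c : Comparison) (hρ : Primrec fun n => (ρ n).code)
    (hφ : Primrec fun n => (φ n).code) : Primrec fun n => (PCTL.next c (ρ n) (φ n)).code :=
  Primrec₂.natPair.comp (.const 4) <| Primrec₂.natPair.comp (.const _) <|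
    Primrec₂.natPair.comp (Primrec₂.natPair.comp (Primrec.fst.comp hρ) (Primrec.snd.comp hρ)) hφ

theorem primrec_code_untl (c : Comparison) (hρ : Primrec fun n => (ρ n).code)
    (hφ : Primrec fun n => (φ n).code) (hψ : Primrec fun n => (ψ n).code) :
    Primrec fun n => (PCTL.untl c (ρ n) (φ n) (ψ n)).code :=
  Primrec₂.natPair.comp (.const 5) <| Primrec₂.natPair.comp (.const _) <| Primrec₂.natPair.comp
    (Primrec₂.natPair.comp (Primrec.fst.comp hρ) (Primrec.snd.comp hρ))
    (Primrec₂.natPair.comp hφ hψ)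

end PCTL

namespace Automaton

open Node Nat.Partrec

theorem exists_forall_accepts_iff_dom_eval : ∃ (k m : ℕ) (D : DFA (Fin k) (Fin m))
    (op : Fin k → Op), ∀ c : Code, Accepts D op (Encodable.encode c) ↔ (c.eval 0).Dom := by
  let f (t n : ℕ) : ℕ := bif (Code.evaln t (Denumerable.ofNat Code n) 0).isSome then 0 else 1
  have hf : Primrec₂ f := .cond (Primrec.option_isSome.comp <| Code.primrec_evaln.comp <|
    (Primrec.fst.pair ((Primrec.ofNat Code).comp .snd)).pair (.const 0)) (.const 0) (.const 1)
  have hdom (c : Code) : (c.eval 0).Dom ↔ ∃ t, f t (Encodable.encode c) = 0 := by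
    have hzero (t : ℕ) : f t (Encodable.encode c) = 0 ↔ ∃ x, x ∈ Code.evaln t c 0 := by
      simp only [f, Denumerable.ofNat_encode, Option.mem_def, ← Option.isSome_iff_exists]
      cases (Code.evaln t c 0).isSome <;> simp
    simp only [Part.dom_iff_mem, hzero, Code.evaln_complete]
    exact exists_comm
  obtain ⟨e, he⟩ := Program.exists_program hf
  obtain ⟨k, op, m, D, hD⟩ := exists_dfa e
  refine ⟨k, m, D, op, fun c => ?_⟩
  rw [hdom, he]
  constructor
  · rintro ⟨w, hw, hacc, hn⟩
    exact ⟨_, ⟨_, (hD _).2 ⟨_, hacc, rfl⟩, hw⟩, hn⟩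
  · rintro ⟨s, ⟨v, hv, hs⟩, hn⟩
    obtain ⟨v, hacc, rfl⟩ := (hD v).1 hv
    obtain ⟨hpass, rfl⟩ := exec_iff_passes (w := v.reverse).1 (by rwa [List.reverse_reverse])
    exact ⟨v.reverse, hpass, by rwa [List.reverse_reverse], hn⟩

theorem code_half_pow (n : ℕ) : (half ^ n).code = (1, 2 ^ n) := by
  have hcoe : ((half ^ n : RatProb) : ℚ) = (1 / 2) ^ n := rfl
  rw [RatProb.code, hcoe, Rat.num_pow, Rat.den_pow]
  norm_num

theorem primrec_code_haltF {k : ℕ} (op : Fin k → Op) : Primrec fun n => (haltF op n).code := by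
  have hpow : Primrec fun n => (half ^ (n + 1)).code := by
    have htwo : Primrec fun n : ℕ => 2 ^ (n + 1) :=
      (Primrec.nat_rec₁ 2 (Primrec.nat_mul.comp .snd (.const 2)).to₂).of_eq fun n => by
        induction n with
        | zero => rfl
        | succ n ih => rw [pow_succ, ← ih]
    simpa only [code_half_pow] using (Primrec.const 1).pair htwo
  have huntl (φ ψ : Formula k) : Primrec fun n => (PCTL.untlEq (half ^ (n + 1)) φ ψ).code :=
    PCTL.primrec_code_conj (PCTL.primrec_code_untl _ hpow (.const _) (.const _))
      (PCTL.primrec_code_untl _ hpow (.const _) (.const _))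
  have hsum (d : Fin k → ℤ) : Primrec fun n => (sumF d n).code :=
    PCTL.primrec_code_next _ (.const _) (PCTL.primrec_code_conj (.const _) (huntl _ _))
  exact PCTL.primrec_code_conj (.const _) <| PCTL.primrec_code_untl _ (.const _) (.const _) <|
    PCTL.primrec_code_conj (.const _) <| PCTL.primrec_code_conj (.const _) (hsum _)

variable {k m : ℕ} {D : DFA (Fin k) (Fin m)} {op : Fin k → Op} {n : ℕ}

theorem valid_neg_haltF : Instance.Valid ⟨grammar D, .neg (haltF op n)⟩ ↔ ¬ Accepts D op n := by
  refine (point D).surjective.forall.trans ⟨fun h ha => h (main []) (sat_haltF.2 ⟨rfl, ha⟩), ?_⟩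
  exact fun h u hu => h (sat_haltF.1 hu).2

theorem satisfiable_haltF : Instance.Satisfiable ⟨grammar D, haltF op n⟩ ↔ Accepts D op n := by
  refine (point D).surjective.exists.trans ⟨fun ⟨u, hu⟩ => (sat_haltF.1 hu).2, ?_⟩
  exact fun h => ⟨main [], sat_haltF.2 ⟨rfl, h⟩⟩

theorem root_mem_vertexSet : Encodable.encode (main (k := k) []) ∈
    vertexSet ((grammar D).ruleGraph (grammar D).start) :=
  (encode_mem_newVertices (A := 0) List.mem_cons_self).1

theorem rootImage_root_mem_vertexSet :
    (grammar D).derivation.rootImage (Encodable.encode (main (k := k) [])) ∈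
      vertexSet (grammar D).graph :=
  (point D (main [])).2

theorem holds_haltF : RootedInstance.Holds ⟨⟨grammar D, haltF op n⟩,
    Encodable.encode (main (k := k) []), root_mem_vertexSet, rootImage_root_mem_vertexSet⟩ ↔
      Accepts D op n :=
  sat_haltF.trans (and_iff_right rfl)

end Automaton
end ProbHypergraph

open ProbHypergraph Automaton Nat.Partrec in
theorem mainTheorem4_general : ∃ (P : PHRGrammar) (x : ℕ)
    (hx : x ∈ vertexSet (P.ruleGraph P.start))
    (hroot : P.derivation.rootImage x ∈ vertexSet P.graph),
    ¬ DecidableProblem PCTL.code (fun φ => Instance.Valid ⟨P, φ⟩) ∧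
    ¬ DecidableProblem PCTL.code (fun φ => Instance.Satisfiable ⟨P, φ⟩) ∧
    ¬ DecidableProblem PCTL.code (fun φ => RootedInstance.Holds ⟨⟨P, φ⟩, x, hx, hroot⟩) := by
  obtain ⟨k, m, D, op, hop⟩ := exists_forall_accepts_iff_dom_eval
  have hhalt : ¬ DecidableProblem Encodable.encode fun c : Code => (c.eval 0).Dom :=
    fun h => ComputablePred.halting_problem 0 h.computablePred
  have hcode : Computable fun n => (haltF op n).code := (primrec_code_haltF op).to_comp
  have hcode_neg : Computable fun n => (PCTL.neg (haltF op n)).code :=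
    (Primrec₂.natPair.comp (.const 2) (primrec_code_haltF op)).to_comp
  refine ⟨grammar D, _, root_mem_vertexSet, rootImage_root_mem_vertexSet,
    fun h => hhalt ?_, fun h => hhalt ?_, fun h => hhalt ?_⟩
  · simpa only [valid_neg_haltF, hop, not_not] using
      (h.comp (fun c : Code => .neg (haltF op (Encodable.encode c))) hcode_neg fun _ => rfl).not
  · simpa only [satisfiable_haltF, hop] using
      h.comp (fun c : Code => haltF op (Encodable.encode c)) hcode fun _ => rfl
  · simpa only [holds_haltF, hop] using
      h.comp (fun c : Code => haltF op (Encodable.encode c)) hcode fun _ => rfl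

theorem mainTheorem4 :
    ¬ ProbHypergraph.DecidableProblem ProbHypergraph.Instance.code
        ProbHypergraph.Instance.Valid ∧
    ¬ ProbHypergraph.DecidableProblem ProbHypergraph.Instance.code
        ProbHypergraph.Instance.Satisfiable ∧
    ¬ ProbHypergraph.DecidableProblem ProbHypergraph.RootedInstance.code
        ProbHypergraph.RootedInstance.Holds := by
  obtain ⟨P, x, hx, hroot, hvalid, hsat, hholds⟩ := mainTheorem4_general
  exact ⟨fun h => hvalid (h.comp _ ((Computable.const P.code).pair .id) fun _ => rfl),
    fun h => hsat (h.comp _ ((Computable.const P.code).pair .id) fun _ => rfl),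
    fun h => hholds (h.comp _
      (((Computable.const P.code).pair .id).pair (.const x)) fun _ => rfl)⟩
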